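/- **Setting.** Let $S$ be a connected Riemann surface (not necessarily compact) and $n\ge 1$ an integer. For a Kähler form $\omega$ on $S$, written $\omega=\frac{\sqrt{-1}}{2}\rho\,dz\wedge d\bar z$ with $\rho>0$ smooth in a local coordinate $z$, its Ricci form is $\mathrm{Ric}(\omega)=-\sqrt{-1}\,\partial\bar\partial\log\rho$. An $n$-tuple $(\omega_1,\dots,\omega_n)$ of Kähler forms on $S$ is a *solution to the $\mathrm{SU}(n+1)$ Toda system* if $$(\mathrm{Ric}(\omega_1),\dots,\mathrm{Ric}(\omega_n))=2(\omega_1,\dots,\omega_n)\,C_n,$$ where $C_n$ is the Cartan matrix of type $A_n$. For $n=1$ this says $\mathrm{Ric}(\omega)=4\omega$ (a conformal spherical metric). A *unitary curve* $f:S\to\mathbb P^n$ is a multi-valued holomorphic map (its germs can be continued analytically along every path in $S$, and any two of its germs are analytic continuations of each other) whose monodromy lies in $\mathrm{PSU}(n+1)$: continuation along a loop changes a germ by post-composition with an element of $\mathrm{PSU}(n+1)$. Multi-valued maps are identified with their sets of germs. A unitary curve is *totally unramified* if for every local holomorphic lift $F$ to $\mathbb C^{n+1}\setminus\{0\}$ of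 a germ of it and every local coordinate $z$, the Wronskian $F\wedge F'\wedge\dots\wedge F^{(n)}$ vanishes nowhere. An *associated curve* of a solution $(\omega_1,\dots,\omega_n)$ is a totally unramified unitary curve $f:S\to\mathbb P^n$ such that, for all local lifts $F$ and for $k=1,\dots,n$, $$\omega_k=\tfrac{\sqrt{-1}}{2}\,\partial\bar\partial\log\big\|F\wedge F'\wedge\dots\wedge F^{(k-1)}\big\|^2 ,$$ i.e. $\omega_k$ is the pullback of the Fubini–Study form $\frac{\sqrt{-1}}2\partial\bar\partial\log\|\cdot\|^2$ by the $k$-th osculating curve $[F\wedge\dots\wedge F^{(k-1)}]$ of $f$ in $\mathbb P(\Lambda^k\mathbb C^{n+1})$. **Theorem.** Let $\omega$ be a solution to the $\mathrm{SU}(2)$ Toda system on $S$ and let $v:S\to\mathbb P^1$ be a curve associated with $\omega$. Let $r_n:\mathbb P^1\to\mathbb P^n$ be the rational normal map $$r_n:[z_0,z_1]\mapsto\left[\sqrt{\tfrac1{n!}}\,z_0^n,\ \sqrt{\tfrac1{(n-1)!\,1!}}\,z_0^{n-1}z_1,\ \dots,\ \sqrt{\tfrac1{(n-j)!\,j!}}\,z_0^{n-j}z_1^{j},\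 \dots,\ \sqrt{\tfrac1{n!}}\,z_1^n\right].$$ Then $\big(i(n+1-i)\,\omega\big)_{i=1}^n$ solves the $\mathrm{SU}(n+1)$ Toda system on $S$. Moreover, the set of all associated curves of this solution is exactly $$\{\,U\circ r_n\circ v : S\to\mathbb P^n \mid U\in\mathrm{PSU}(n+1)\,\}.$$ -/

import Mathlib

open scoped Manifold ContDiff Topology

noncomputable section

namespace Toda

/-! ### Kähler forms and Ricci forms on a Riemann surface -/

section Forms

variable (S : Type*) [TopologicalSpace S] [ChartedSpace ℂ S]

/-- Real-valued 2-forms on the surface `S` (regarded as a real surface). -/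
abbrev TwoForm : Type _ :=
  (x : S) → (TangentSpace 𝓘(ℂ) x) [⋀^Fin 2]→ₗ[ℝ] ℝ

variable {S}

/-- The 2-form `dx ∧ dy = (√-1 / 2) dz ∧ dz̄` of the chart `e = z = x + √-1 y`, at the point `p`:
the pullback under the derivative of `e` of the determinant with respect to the basis `1, √-1`
of `ℂ`. -/
def areaForm (e : OpenPartialHomeomorph S ℂ) (p : S) :
    (TangentSpace 𝓘(ℂ) p) [⋀^Fin 2]→ₗ[ℝ] ℝ :=
  AlternatingMap.compLinearMap
    (Complex.basisOneI.det : (TangentSpace 𝓘(ℂ) (e p)) [⋀^Fin 2]→ₗ[ℝ] ℝ)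
    ((mfderiv 𝓘(ℂ) 𝓘(ℂ) e p).toLinearMap.restrictScalars ℝ)

/-- The coefficient `ρ` of a 2-form `Ω = ρ dx ∧ dy = (√-1 / 2) ρ dz ∧ dz̄` in the chart `e`, as a
function of the coordinate `z`: the value of `Ω` on `∂/∂x, ∂/∂y`. -/
def density (e : OpenPartialHomeomorph S ℂ) (Ω : TwoForm S) (z : ℂ) : ℝ :=
  Ω (e.symm z)
    ![mfderiv 𝓘(ℂ) 𝓘(ℂ) e.symm z (1 : ℂ), mfderiv 𝓘(ℂ) 𝓘(ℂ) e.symm z Complex.I]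

/-- Kähler forms on a Riemann surface: smooth real 2-forms with `Ω (v, J v) > 0` for `v ≠ 0`, where
`J` is multiplication by `√-1`.  In complex dimension one every real 2-form is closed and of
type `(1,1)`. -/
structure IsKahlerForm (Ω : TwoForm S) : Prop where
  smooth : ∀ e ∈ atlas ℂ S, ContDiffOn ℝ ∞ (density e Ω) e.target
  pos : ∀ (x : S) (v : TangentSpace 𝓘(ℂ) x), v ≠ 0 → 0 < Ω x ![v, Complex.I • v]

/-- `∂²φ/∂z∂z̄ = (1/4) Δ φ`. -/
def dzdzbar (φ : ℂ → ℝ) (z : ℂ) : ℝ := (1 / 4) * Laplacian.laplacian φ z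

/-- The 2-form `√-1 ∂∂̄ φ = √-1 (∂²φ/∂z∂z̄) dz ∧ dz̄` at `p`, for a function `φ` of the coordinate
`z` of the chart `e`.  Note `√-1 dz ∧ dz̄ = 2 dx ∧ dy`. -/
def iDDbar (e : OpenPartialHomeomorph S ℂ) (φ : ℂ → ℝ) (p : S) :
    (TangentSpace 𝓘(ℂ) p) [⋀^Fin 2]→ₗ[ℝ] ℝ :=
  (2 * dzdzbar φ (e p)) • areaForm e p

/-- The Ricci form `Ric(Ω) = -√-1 ∂∂̄ log ρ`, where `Ω = (√-1 / 2) ρ dz ∧ dz̄`; it does not depend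
on the coordinate, and is computed at `p` in the preferred chart at `p`. -/
def ricciForm (Ω : TwoForm S) : TwoForm S := fun p =>
  -iDDbar (chartAt ℂ p) (fun z => Real.log (density (chartAt ℂ p) Ω z)) p

/-- Solutions `(Ω₁, …, Ωₙ)` of the `SU(n+1)` Toda system: Kähler forms with
`(Ric Ω₁, …, Ric Ωₙ) = 2 (Ω₁, …, Ωₙ) Cₙ`, where `Cₙ` is the Cartan matrix of type `Aₙ`. -/
structure IsTodaSolution (n : ℕ) (Ω : Fin n → TwoForm S) : Prop where
  kahler : ∀ i, IsKahlerForm (Ω i)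
  ricci_eq : ∀ i p,
    ricciForm (Ω i) p = (2 : ℝ) • ∑ j, ((CartanMatrix.A n j i : ℤ) : ℝ) • Ω j p

end Forms

/-! ### Projective spaces, unitary transformations and the rational normal map -/

/-- Complex projective space `ℙⁿ`, the space of lines in `ℂⁿ⁺¹`. -/
abbrev CP (n : ℕ) : Type := Projectivization ℂ (Fin (n + 1) → ℂ)

theorem specialUnitary_injective {n : ℕ} (U : Matrix.specialUnitaryGroup (Fin (n + 1)) ℂ) :
    Function.Injective (Matrix.toLin' (U : Matrix (Fin (n + 1)) (Fin (n + 1)) ℂ)) := by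
  have hU : star (U : Matrix (Fin (n + 1)) (Fin (n + 1)) ℂ) * U = 1 :=
    Matrix.mem_unitaryGroup_iff'.1 (Matrix.specialUnitaryGroup_le_unitaryGroup U.2)
  intro a b hab
  have h := congrArg (Matrix.mulVec (star (U : Matrix (Fin (n + 1)) (Fin (n + 1)) ℂ))) hab
  simpa [Matrix.toLin'_apply, Matrix.mulVec_mulVec, hU] using h

/-- The transformation of `ℙⁿ` induced by `U ∈ SU(n+1)`; these are the elements of
`PSU(n+1)`. -/
def psuMap {n : ℕ} (U : Matrix.specialUnitaryGroup (Fin (n + 1)) ℂ) : CP n → CP n :=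
  Projectivization.map (Matrix.toLin' (U : Matrix (Fin (n + 1)) (Fin (n + 1)) ℂ))
    (specialUnitary_injective U)

/-- The vector with coordinates `√(1 / ((n-j)! j!)) z₀ⁿ⁻ʲ z₁ʲ`, `j = 0, …, n`. -/
def rationalNormalVec (n : ℕ) (z : Fin (1 + 1) → ℂ) : Fin (n + 1) → ℂ := fun j =>
  ((Real.sqrt (1 / ((Nat.factorial (n - (j : ℕ)) : ℝ) * (Nat.factorial (j : ℕ) : ℝ))) : ℝ) : ℂ)
    * z 0 ^ (n - (j : ℕ)) * z 1 ^ (j : ℕ)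

theorem rationalNormalVec_ne_zero (n : ℕ) {z : Fin (1 + 1) → ℂ} (hz : z ≠ 0) :
    rationalNormalVec n z ≠ 0 := by
  have hs : ∀ j : Fin (n + 1), ((Real.sqrt
      (1 / ((Nat.factorial (n - (j : ℕ)) : ℝ) * (Nat.factorial (j : ℕ) : ℝ))) : ℝ) : ℂ) ≠ 0 := by
    intro j
    have : 0 < Real.sqrt
        (1 / ((Nat.factorial (n - (j : ℕ)) : ℝ) * (Nat.factorial (j : ℕ) : ℝ))) := by
      apply Real.sqrt_pos.2
      positivity
    exact_mod_cast this.ne'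
  intro h
  have key : ∀ j : Fin (n + 1), z 0 ^ (n - (j : ℕ)) * z 1 ^ (j : ℕ) = 0 := by
    intro j
    have hj : rationalNormalVec n z j = 0 := congrFun h j
    rw [rationalNormalVec, mul_assoc] at hj
    exact (mul_eq_zero.1 hj).resolve_left (hs j)
  have h0 : z 0 ^ n = 0 := by simpa using key 0
  have hn : z 1 ^ n = 0 := by simpa using key (Fin.last n)
  apply hz
  funext i
  fin_cases i
  · exact eq_zero_of_pow_eq_zero h0
  · exact eq_zero_of_pow_eq_zero hn

theorem rationalNormalVec_smul (n : ℕ) (t : ℂ) (z : Fin (1 + 1) → ℂ) :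
    rationalNormalVec n (t • z) = t ^ n • rationalNormalVec n z := by
  funext j
  have hj : n = (n - (j : ℕ)) + (j : ℕ) := by omega
  have ht : t ^ n = t ^ (n - (j : ℕ)) * t ^ (j : ℕ) := by rw [← pow_add, ← hj]
  simp only [rationalNormalVec, Pi.smul_apply, smul_eq_mul, mul_pow, ht]
  ring

/-- The rational normal map
`[z₀, z₁] ↦ [√(1/n!) z₀ⁿ, √(1/((n-1)! 1!)) z₀ⁿ⁻¹ z₁, …, √(1/n!) z₁ⁿ]`. -/
def rationalNormalMap (n : ℕ) : CP 1 → CP n :=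
  Projectivization.lift
    (fun z => Projectivization.mk ℂ (rationalNormalVec n z.1) (rationalNormalVec_ne_zero n z.2))
    (by
      intro a b t hab
      rw [Projectivization.mk_eq_mk_iff']
      exact ⟨t ^ n, by rw [hab, rationalNormalVec_smul]⟩)

/-! ### Multi-valued maps -/

section Germs

/-- Germs of maps from `S` to `Y`, together with their base points. -/
abbrev GermAt (S : Type*) [TopologicalSpace S] (Y : Type*) : Type _ :=
  Σ x : S, Filter.Germ (𝓝 x) Y

variable {S : Type*} [TopologicalSpace S] {Y Z : Type*}

/-- The germ of `h` at `x`. -/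
def germAt (h : S → Y) (x : S) : GermAt S Y := ⟨x, (h : Filter.Germ (𝓝 x) Y)⟩

/-- Composition of a germ with a map of the target. -/
def GermAt.post (φ : Y → Z) (p : GermAt S Y) : GermAt S Z := ⟨p.1, p.2.map φ⟩

/-- `Γ` is a continuation of germs along the path of its base points: near each time, the germs are
the germs of one and the same map.  (For germs of holomorphic maps this is analytic
continuation.) -/
def IsContinuation (Γ : unitInterval → GermAt S Y) : Prop :=
  Continuous (fun t => (Γ t).1) ∧
    ∀ t, ∃ h : S → Y, ∀ᶠ s in 𝓝 t, Γ s = germAt h (Γ s).1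

/-- Composition `φ ∘ f` of a multi-valued map `f`, given as the set of all its germs, with a map
`φ` of the target. -/
def postcomp (φ : Y → Z) (f : Set (GermAt S Y)) : Set (GermAt S Z) := GermAt.post φ '' f

end Germs

section Curves

variable {S : Type*} [TopologicalSpace S] [ChartedSpace ℂ S] {n : ℕ}

/-- `F` is a holomorphic lift to `ℂⁿ⁺¹ ∖ {0}`, in terms of the coordinate `e`, of the germ `p` of a
map to `ℙⁿ`. -/
structure IsLift (e : OpenPartialHomeomorph S ℂ) (p : GermAt S (CP n))
    (F : ℂ → Fin (n + 1) → ℂ) : Prop where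
  analytic : AnalyticAt ℂ F (e p.1)
  lifts : ∃ h : S → CP n, p = germAt h p.1 ∧
    ∀ᶠ y in 𝓝 p.1, ∃ hy : F (e y) ≠ 0, h y = Projectivization.mk ℂ (F (e y)) hy

/-- The Wronskian `F ∧ F' ∧ ⋯ ∧ F⁽ⁿ⁾`. -/
def wronskian (F : ℂ → Fin (n + 1) → ℂ) (z : ℂ) : ℂ :=
  (Matrix.of fun i j : Fin (n + 1) => iteratedDeriv (i : ℕ) F z j).det

/-- `‖F ∧ F' ∧ ⋯ ∧ F⁽ᵏ⁻¹⁾‖²` in `Λᵏ ℂⁿ⁺¹` with the Hermitian norm induced by the standard one of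
`ℂⁿ⁺¹`: the Gram determinant of `F, F', …, F⁽ᵏ⁻¹⁾`. -/
def wedgeNormSq (k : ℕ) (F : ℂ → Fin (n + 1) → ℂ) (z : ℂ) : ℝ :=
  (Matrix.of fun i j : Fin k =>
    ∑ l, iteratedDeriv (i : ℕ) F z l * (starRingEnd ℂ) (iteratedDeriv (j : ℕ) F z l)).det.re

/-- Multi-valued holomorphic maps `S → ℙⁿ`, each given as the set of all its germs: the germs are
holomorphic, can be continued analytically along every path of `S`, and all arise from one of them
by such continuations. -/
structure IsMultivaluedCurve (f : Set (GermAt S (CP n))) : Prop where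
  nonempty : f.Nonempty
  holomorphic : ∀ p ∈ f, ∀ e ∈ atlas ℂ S, p.1 ∈ e.source → ∃ F, IsLift e p F
  isOpen : ∀ (h : S → CP n) (x : S), germAt h x ∈ f → ∀ᶠ y in 𝓝 x, germAt h y ∈ f
  continuation : ∀ p ∈ f, ∀ γ : C(unitInterval, S), γ 0 = p.1 →
    ∃ Γ : unitInterval → GermAt S (CP n),
      IsContinuation Γ ∧ Γ 0 = p ∧ ∀ t, (Γ t).1 = γ t ∧ Γ t ∈ f
  connected : ∀ p ∈ f, ∀ q ∈ f, ∃ Γ : unitInterval → GermAt S (CP n),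
    IsContinuation Γ ∧ Γ 0 = p ∧ Γ 1 = q ∧ ∀ t, Γ t ∈ f

/-- Unitary curves: multi-valued holomorphic maps `S → ℙⁿ` with monodromy in `PSU(n+1)`, that is,
analytic continuation along a loop changes a germ by an element of `PSU(n+1)`. -/
structure IsUnitaryCurve (f : Set (GermAt S (CP n))) : Prop extends IsMultivaluedCurve f where
  monodromy : ∀ Γ : unitInterval → GermAt S (CP n), IsContinuation Γ → (∀ t, Γ t ∈ f) →
    (Γ 0).1 = (Γ 1).1 →
      ∃ U : Matrix.specialUnitaryGroup (Fin (n + 1)) ℂ, Γ 1 = (Γ 0).post (psuMap U)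

/-- Totally unramified: the Wronskian of a local lift vanishes nowhere. -/
def IsTotallyUnramified (f : Set (GermAt S (CP n))) : Prop :=
  ∀ p ∈ f, ∀ e ∈ atlas ℂ S, p.1 ∈ e.source → ∀ F, IsLift e p F → wronskian F (e p.1) ≠ 0

/-- `f` is an associated curve of `(Ω₁, …, Ωₙ)`: `f` is a totally unramified unitary curve and, for
`k = 1, …, n`, the form `Ωₖ` is the pullback of the Fubini–Study form `(√-1 / 2) ∂∂̄ log ‖·‖²` under
the `k`-th osculating curve `[F ∧ F' ∧ ⋯ ∧ F⁽ᵏ⁻¹⁾] : S → ℙ(Λᵏ ℂⁿ⁺¹)` of `f = [F]`. -/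
structure IsAssociatedCurve (Ω : Fin n → TwoForm S) (f : Set (GermAt S (CP n))) : Prop where
  unitary : IsUnitaryCurve f
  unramified : IsTotallyUnramified f
  pullback_eq : ∀ p ∈ f, ∀ e ∈ atlas ℂ S, p.1 ∈ e.source → ∀ F, IsLift e p F → ∀ k : Fin n,
    Ω k p.1 = (1 / 2 : ℝ) • iDDbar e (fun z => Real.log (wedgeNormSq ((k : ℕ) + 1) F z)) p.1

end Curves

/-- The tuple `(i (n + 1 - i) Ω)`, `i = 1, …, n` (the index `k : Fin n` stands for `i = k + 1`). -/
def reducedTuple {S : Type*} [TopologicalSpace S] [ChartedSpace ℂ S] (n : ℕ) (Ω : TwoForm S) :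
    Fin n → TwoForm S := fun k x =>
  ((((k : ℕ) : ℝ) + 1) * ((n : ℝ) + 1 - (((k : ℕ) : ℝ) + 1))) • Ω x

end Toda

end

/-! The system for the tuple is arithmetic. Scaling a Kähler form by a constant leaves its Ricci
form unchanged, and `Ric Ω = 4 Ω`, so all that is needed is that the Cartan matrix sends the vector
`i (n + 1 - i)` to the constant vector 2 (`sum_cartanMatrix_A_mul`).

That `U ∘ r_n ∘ v` is associated rests on the identity `⟨r_n z, r_n w⟩ = ⟨z, w⟩ⁿ / n!`. Families
with equal Gram matrices differ by a unitary map, so `r_n` is equivariant under unitary groups; this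
carries the monodromy over to `PSU(n+1)`. It also allows a lift `F` of `v` to be rotated at a given
point until its second coordinate vanishes there, where the jet of `r_n ∘ F` becomes triangular. The
result is the norm formula `wedgeNormSq_rationalNormalVec`: the squared norm of the osculating
`(k+1)`-vector is a constant times `|W|^(k(k+1)) ‖F‖^(2(k+1)(n-k))`, with `W` the Wronskian of `F`.
Since `log |W|` is harmonic, the Laplacian of the logarithm gives the factor `(k+1)(n-k)`, and the
case `k = n` gives total unramifiedness.

Conversely, an associated curve `f` of the tuple and the curve `r_n ∘ v` pull back the Fubini–Study
form to the same form `n Ω`. Calabi's rigidity (`exists_specialUnitary_of_laplacian_eq`) makes their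
germs over a common point agree up to some `U`. Uniqueness of analytic continuation spreads this to
all germs (`IsMultivaluedCurve.eq_postcomp`). -/

namespace Toda

/-! ### Unitary maps from Gram matrices -/

section Gram

open Matrix

theorem inner_eq_of_unitary {n : ℕ} {U : Matrix (Fin n) (Fin n) ℂ}
    (hU : U ∈ Matrix.unitaryGroup (Fin n) ℂ) (x y : Fin n → ℂ) :
    star (U *ᵥ x) ⬝ᵥ (U *ᵥ y) = star x ⬝ᵥ y := by
  rw [star_mulVec, ← dotProduct_mulVec, mulVec_mulVec, ← star_eq_conjTranspose,
    mem_unitaryGroup_iff'.1 hU, one_mulVec]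

/-- A unitary matrix is a unit scalar times a special unitary one. -/
theorem exists_smul_specialUnitary {n : ℕ} {M : Matrix (Fin (n + 1)) (Fin (n + 1)) ℂ}
    (hM : M ∈ Matrix.unitaryGroup (Fin (n + 1)) ℂ) :
    ∃ (U : Matrix.specialUnitaryGroup (Fin (n + 1)) ℂ) (c : ℂ), c ≠ 0 ∧
      M = c • (U : Matrix (Fin (n + 1)) (Fin (n + 1)) ℂ) := by
  have hd : ‖M.det‖ = 1 := CStarRing.norm_of_mem_unitary (Matrix.det_of_mem_unitary hM)
  -- Dividing by an (n+1)-st root of the determinant makes the determinant 1; the root has modulus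
  -- 1, so the quotient stays unitary.
  obtain ⟨c, hc⟩ := IsAlgClosed.exists_pow_nat_eq M.det (Nat.succ_pos n)
  have hcn : ‖c‖ = 1 := by
    have : ‖c‖ ^ (n + 1) = 1 := by rw [← norm_pow, hc, hd]
    exact (pow_eq_one_iff_of_nonneg (norm_nonneg _) (Nat.succ_ne_zero n)).1 this
  have hc0 : c ≠ 0 := by
    rintro rfl
    simp at hcn
  have hcc : c * star c = 1 := by
    rw [Complex.star_def, Complex.mul_conj, Complex.normSq_eq_norm_sq, hcn]; simp
  refine ⟨⟨c⁻¹ • M, Matrix.mem_specialUnitaryGroup_iff.2 ⟨?_, ?_⟩⟩, c, hc0, ?_⟩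
  · rw [mem_unitaryGroup_iff, star_smul, smul_mul_smul_comm, mem_unitaryGroup_iff.1 hM, star_inv₀,
      ← mul_inv, hcc]
    simp
  · rw [det_smul, Fintype.card_fin, inv_pow, ← hc, inv_mul_cancel₀ (pow_ne_zero _ hc0)]
  · simp [smul_smul, hc0]

/-- Two families of vectors with the same Gram matrix differ by a unitary transformation. -/
theorem exists_unitary_of_gram_eq {n : ℕ} {ι : Type*} (u w : ι → Fin n → ℂ)
    (h : ∀ i j, star (u i) ⬝ᵥ u j = star (w i) ⬝ᵥ w j) :
    ∃ M ∈ Matrix.unitaryGroup (Fin n) ℂ, ∀ i, w i = M *ᵥ u i := by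
  let a : ι → EuclideanSpace ℂ (Fin n) := fun i => WithLp.toLp 2 (u i)
  let b : ι → EuclideanSpace ℂ (Fin n) := fun i => WithLp.toLp 2 (w i)
  have hab : ∀ i j, inner ℂ (a i) (a j) = inner ℂ (b i) (b j) := by
    intro i j
    simp only [a, b, EuclideanSpace.inner_toLp_toLp]
    rw [dotProduct_comm, h i j, dotProduct_comm]
  -- On formal linear combinations, equal Gram matrices give `‖A f‖ = ‖B f‖`. Hence `A f ↦ B f` is a
  -- well-defined isometry on the span of the first family, and it extends to the whole space.
  let A := Finsupp.linearCombination ℂ a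
  let B := Finsupp.linearCombination ℂ b
  have hin : ∀ f, ‖A f‖ = ‖B f‖ := by
    intro f
    have : inner ℂ (A f) (A f) = inner ℂ (B f) (B f) := by
      simp only [A, B, Finsupp.linearCombination_apply, Finsupp.sum_inner, Finsupp.inner_sum,
        inner_smul_left, inner_smul_right, hab]
    rw [inner_self_eq_norm_sq_to_K, inner_self_eq_norm_sq_to_K] at this
    have h2 : ‖A f‖ ^ 2 = ‖B f‖ ^ 2 := by exact_mod_cast this
    exact (sq_eq_sq₀ (norm_nonneg _) (norm_nonneg _)).1 h2
  -- Any linear section of `A` will do: two preimages differ by an element of the kernel of `A`,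
  -- which `B` kills as well by `hin`.
  obtain ⟨g, hg⟩ := A.rangeRestrict.exists_rightInverse_of_surjective
    (LinearMap.range_eq_top.2 A.surjective_rangeRestrict)
  have hAg : ∀ x : A.range, A (g x) = x := fun x => by
    have := LinearMap.congr_fun hg x
    exact congrArg Subtype.val this
  let L : A.range →ₗᵢ[ℂ] EuclideanSpace ℂ (Fin n) := ⟨B ∘ₗ g, fun x => by
    change ‖B (g x)‖ = ‖(x : EuclideanSpace ℂ (Fin n))‖
    rw [← hin, hAg]⟩
  have hL : ∀ f, L ⟨A f, LinearMap.mem_range_self A f⟩ = B f := by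
    intro f
    change B (g _) = B f
    rw [← sub_eq_zero, ← map_sub, ← norm_eq_zero, ← hin, map_sub, hAg]
    simp
  let E : EuclideanSpace ℂ (Fin n) ≃ₗᵢ[ℂ] EuclideanSpace ℂ (Fin n) := L.extend.toLinearIsometryEquiv rfl
  have hE : ∀ i, E (a i) = b i := by
    intro i
    have h1 := L.extend_apply ⟨A (Finsupp.single i 1), LinearMap.mem_range_self A _⟩
    rw [hL] at h1
    change L.extend (a i) = b i
    simpa [A, B] using h1
  let bs := EuclideanSpace.basisFun (Fin n) ℂ
  refine ⟨LinearMap.toMatrix bs.toBasis bs.toBasis E.toLinearEquiv.toLinearMap,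
    E.toMatrix_mem_unitaryGroup bs bs, fun i => ?_⟩
  have h2 := LinearMap.toMatrix_mulVec_repr bs.toBasis bs.toBasis
    E.toLinearEquiv.toLinearMap (a i)
  have h3 : E.toLinearEquiv.toLinearMap (a i) = b i := hE i
  rw [h3] at h2
  funext j
  have h4 := congrFun h2 j
  have h5 : ⇑(bs.toBasis.repr (a i)) = u i := by
    funext k
    simp [bs, a]
  rw [h5] at h4
  rw [h4]
  simp [bs, b]

theorem exists_specialUnitary_of_gram_eq {n : ℕ} {ι : Type*} (u w : ι → Fin (n + 1) → ℂ)
    (h : ∀ i j, star (u i) ⬝ᵥ u j = star (w i) ⬝ᵥ w j) :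
    ∃ (U : Matrix.specialUnitaryGroup (Fin (n + 1)) ℂ) (c : ℂ), c ≠ 0 ∧
      ∀ i, w i = c • ((U : Matrix (Fin (n + 1)) (Fin (n + 1)) ℂ) *ᵥ u i) := by
  obtain ⟨M, hM, hw⟩ := exists_unitary_of_gram_eq u w h
  obtain ⟨U, c, hc, rfl⟩ := exists_smul_specialUnitary hM
  exact ⟨U, c, hc, fun i => by rw [hw i, smul_mulVec]⟩

end Gram

/-! ### Equivariance of the rational normal map -/

section RationalNormal

open Matrix

/-- The squared coefficients of `r_n` are binomial coefficients divided by `n!`, so the Hermitian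
product is a binomial expansion. -/
theorem rationalNormalVec_dotProduct (n : ℕ) (z w : Fin (1 + 1) → ℂ) :
    star (rationalNormalVec n z) ⬝ᵥ rationalNormalVec n w =
      (star z ⬝ᵥ w) ^ n / (n.factorial : ℂ) := by
  have hn : (n.factorial : ℂ) ≠ 0 := by exact_mod_cast n.factorial_ne_zero
  -- The coordinate 1 is written first so that `add_pow` gives it the exponent `j`.
  have hz : star z ⬝ᵥ w = star (z 1) * w 1 + star (z 0) * w 0 := by
    simp [dotProduct, Fin.sum_univ_two, add_comm]
  rw [hz, eq_div_iff hn, add_pow, Finset.sum_range, dotProduct, Finset.sum_mul]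
  refine Finset.sum_congr rfl fun j _ => ?_
  have hj : (j : ℕ) ≤ n := Nat.lt_succ_iff.1 j.2
  set s : ℝ := Real.sqrt (1 / (((n - (j : ℕ)).factorial : ℝ) * ((j : ℕ).factorial : ℝ))) with hs
  have hss : s * s = 1 / (((n - (j : ℕ)).factorial : ℝ) * ((j : ℕ).factorial : ℝ)) :=
    Real.mul_self_sqrt (by positivity)
  have hf : (((n - (j : ℕ)).factorial : ℝ) * ((j : ℕ).factorial : ℝ)) ≠ 0 := by positivity
  have hch : (s * s) * n.factorial = (n.choose j : ℝ) := by
    rw [hss, ← Nat.choose_mul_factorial_mul_factorial hj]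
    push_cast
    field_simp
  have hchC : (s : ℂ) * s * n.factorial = (n.choose j : ℂ) := by exact_mod_cast hch
  simp only [rationalNormalVec, Pi.star_apply, ← hs, ← hchC, star_mul', star_pow, mul_pow]
  have : star (s : ℂ) = s := Complex.conj_ofReal s
  rw [this]
  ring

/-- The action of `SU(2)` on binary forms of degree `n` is by unitary transformations. -/
theorem exists_unitary_rationalNormalVec (n : ℕ) {V : Matrix (Fin (1 + 1)) (Fin (1 + 1)) ℂ}
    (hV : V ∈ Matrix.unitaryGroup (Fin (1 + 1)) ℂ) :
    ∃ M ∈ Matrix.unitaryGroup (Fin (n + 1)) ℂ, ∀ z,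
      rationalNormalVec n (V *ᵥ z) = M *ᵥ rationalNormalVec n z :=
  -- The Gram function of `r_n` depends only on the Hermitian product in `ℂ²`, which `V` preserves.
  exists_unitary_of_gram_eq (fun z => rationalNormalVec n z)
    (fun z => rationalNormalVec n (V *ᵥ z)) fun z w => by
      simp only [rationalNormalVec_dotProduct, inner_eq_of_unitary hV]

theorem psuMap_mk {n : ℕ} (U : Matrix.specialUnitaryGroup (Fin (n + 1)) ℂ) (z : Fin (n + 1) → ℂ)
    (hz : z ≠ 0) :
    ∃ h, psuMap U (Projectivization.mk ℂ z hz) =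
      Projectivization.mk ℂ ((U : Matrix (Fin (n + 1)) (Fin (n + 1)) ℂ) *ᵥ z) h := by
  refine ⟨fun h => hz (specialUnitary_injective U ?_), ?_⟩
  · simpa using h
  · rfl

theorem rationalNormalMap_mk (n : ℕ) (z : Fin (1 + 1) → ℂ) (hz : z ≠ 0) :
    rationalNormalMap n (Projectivization.mk ℂ z hz) =
      Projectivization.mk ℂ (rationalNormalVec n z) (rationalNormalVec_ne_zero n hz) := rfl

theorem psuMap_mul {n : ℕ} (U V : Matrix.specialUnitaryGroup (Fin (n + 1)) ℂ) (p : CP n) :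
    psuMap (U * V) p = psuMap U (psuMap V p) := by
  induction p using Projectivization.ind with
  | h z hz =>
    obtain ⟨h1, e1⟩ := psuMap_mk V z hz
    obtain ⟨h2, e2⟩ := psuMap_mk U _ h1
    obtain ⟨h3, e3⟩ := psuMap_mk (U * V) z hz
    rw [e1, e2, e3, Projectivization.mk_eq_mk_iff']
    exact ⟨1, by simp [mulVec_mulVec]⟩

/-- The rational normal map is equivariant. -/
theorem exists_rationalNormalMap_comp_psuMap (n : ℕ)
    (V : Matrix.specialUnitaryGroup (Fin (1 + 1)) ℂ) :
    ∃ U : Matrix.specialUnitaryGroup (Fin (n + 1)) ℂ, ∀ p,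
      rationalNormalMap n (psuMap V p) = psuMap U (rationalNormalMap n p) := by
  obtain ⟨M, hM, h⟩ := exists_unitary_rationalNormalVec n
    (Matrix.specialUnitaryGroup_le_unitaryGroup V.2)
  obtain ⟨U, c, hc, rfl⟩ := exists_smul_specialUnitary hM
  refine ⟨U, fun p => ?_⟩
  induction p using Projectivization.ind with
  | h z hz =>
    obtain ⟨h1, e1⟩ := psuMap_mk V z hz
    obtain ⟨h2, e2⟩ := psuMap_mk U _ (rationalNormalVec_ne_zero n hz)
    rw [e1, rationalNormalMap_mk, rationalNormalMap_mk, e2, Projectivization.mk_eq_mk_iff']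
    exact ⟨c, by rw [h z, smul_mulVec]⟩

end RationalNormal

end Toda

namespace Toda

/-! ### Jets, Wronskians and osculating norms -/

section Jets

open Matrix

theorem iteratedDeriv_clm_comp {E G : Type*} [NormedAddCommGroup E] [NormedSpace ℂ E]
    [NormedAddCommGroup G] [NormedSpace ℂ G] (L : E →L[ℂ] G) {F : ℂ → E} {z : ℂ} (i : ℕ)
    (hF : ContDiffAt ℂ i F z) :
    iteratedDeriv i (fun w => L (F w)) z = L (iteratedDeriv i F z) := by
  have := L.iteratedFDeriv_comp_left hF (i := i) le_rfl
  simp only [iteratedDeriv]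
  change iteratedFDeriv ℂ i (L ∘ F) z _ = _
  rw [this]
  rfl

theorem iteratedDeriv_apply {m : ℕ} {F : ℂ → Fin m → ℂ} {z : ℂ} (hF : AnalyticAt ℂ F z)
    (i : ℕ) (j : Fin m) : iteratedDeriv i F z j = iteratedDeriv i (fun w => F w j) z :=
  (iteratedDeriv_clm_comp (ContinuousLinearMap.proj j) i hF.contDiffAt).symm

/-- The matrix with rows `F, F', …, F⁽ᵏ⁻¹⁾`. -/
noncomputable def jet {n : ℕ} (k : ℕ) (F : ℂ → Fin (n + 1) → ℂ) (z : ℂ) : Matrix (Fin k) (Fin (n + 1)) ℂ :=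
  Matrix.of fun i j => iteratedDeriv (i : ℕ) F z j

variable {n : ℕ}

theorem wronskian_eq_det_jet (F : ℂ → Fin (n + 1) → ℂ) (z : ℂ) :
    wronskian F z = (jet (n + 1) F z).det := rfl

theorem wedgeNormSq_eq_det_jet (k : ℕ) (F : ℂ → Fin (n + 1) → ℂ) (z : ℂ) :
    wedgeNormSq k F z = (jet k F z * (jet k F z)ᴴ).det.re := by
  rw [wedgeNormSq]
  congr 2

theorem jet_congr (k : ℕ) {F G : ℂ → Fin (n + 1) → ℂ} {z : ℂ} (h : F =ᶠ[𝓝 z] G) :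
    jet k F z = jet k G z := by
  ext i j
  simp only [jet, Matrix.of_apply, h.iteratedDeriv_eq]

theorem jet_mulVec (k : ℕ) (M : Matrix (Fin (n + 1)) (Fin (n + 1)) ℂ) {F : ℂ → Fin (n + 1) → ℂ}
    {z : ℂ} (hF : AnalyticAt ℂ F z) :
    jet k (fun w => M *ᵥ F w) z = jet k F z * Mᵀ := by
  ext i j
  have := iteratedDeriv_clm_comp (LinearMap.toContinuousLinearMap (Matrix.mulVecLin M)) i
    (hF.contDiffAt (n := i))
  simp only [LinearMap.coe_toContinuousLinearMap', mulVecLin_apply] at this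
  simp only [jet, Matrix.of_apply, this, mul_apply, mulVec, dotProduct, transpose_apply]
  exact Finset.sum_congr rfl fun l _ => mul_comm _ _

/-- By the Leibniz rule, the rows of the new jet are lower triangular combinations of the old rows,
with `c z` on the diagonal. -/
theorem jet_smul (k : ℕ) {c : ℂ → ℂ} {F : ℂ → Fin (n + 1) → ℂ} {z : ℂ} (hc : AnalyticAt ℂ c z)
    (hF : AnalyticAt ℂ F z) :
    ∃ T : Matrix (Fin k) (Fin k) ℂ, T.det = c z ^ k ∧ jet k (fun w => c w • F w) z = T * jet k F z := by
  refine ⟨Matrix.of fun i j => if j ≤ i then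
    ((i : ℕ).choose j : ℂ) * iteratedDeriv ((i : ℕ) - j) c z else 0, ?_, ?_⟩
  · rw [Matrix.det_of_isLowerTriangular]
    · simp
    · intro i j hij
      have : ¬ j ≤ i := not_le.2 hij
      simp [this]
  · ext i j
    have hcF : AnalyticAt ℂ (fun w => c w • F w) z := hc.smul hF
    have hFj : AnalyticAt ℂ (fun w => F w j) z := (analyticAt_pi_iff.1 hF) j
    rw [jet, Matrix.of_apply, iteratedDeriv_apply hcF, mul_apply]
    have h1 : (fun w => (c w • F w) j) = (fun w => F w j) * c := by
      funext w; simp [mul_comm]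
    rw [h1, iteratedDeriv_mul hFj.contDiffAt hc.contDiffAt]
    simp only [Matrix.of_apply, jet, iteratedDeriv_apply hF, ite_mul, zero_mul]
    rw [← Finset.sum_filter]
    refine (Finset.sum_bij (fun (a : Fin k) _ => (a : ℕ)) ?_ ?_ ?_ ?_).symm
    · intro a ha
      have : a ≤ i := by simpa using ha
      exact Finset.mem_range.2 (Nat.lt_succ_of_le this)
    · intro a _ b _ hab
      exact Fin.ext hab
    · intro b hb
      have hb' : b ≤ i := Nat.lt_succ_iff.1 (Finset.mem_range.1 hb)
      exact ⟨⟨b, lt_of_le_of_lt hb' i.2⟩,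
        Finset.mem_filter.2 ⟨Finset.mem_univ _, Fin.le_def.2 hb'⟩, rfl⟩
    · intro a _
      ring

theorem wronskian_smul {c : ℂ → ℂ} {F : ℂ → Fin (n + 1) → ℂ} {z : ℂ} (hc : AnalyticAt ℂ c z)
    (hF : AnalyticAt ℂ F z) :
    wronskian (fun w => c w • F w) z = c z ^ (n + 1) * wronskian F z := by
  obtain ⟨T, hT, h⟩ := jet_smul (n + 1) hc hF
  rw [wronskian_eq_det_jet, h, det_mul, hT, wronskian_eq_det_jet]

theorem wronskian_mulVec (M : Matrix (Fin (n + 1)) (Fin (n + 1)) ℂ) {F : ℂ → Fin (n + 1) → ℂ}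
    {z : ℂ} (hF : AnalyticAt ℂ F z) :
    wronskian (fun w => M *ᵥ F w) z = M.det * wronskian F z := by
  rw [wronskian_eq_det_jet, jet_mulVec _ _ hF, det_mul, det_transpose, mul_comm,
    wronskian_eq_det_jet]

theorem wedgeNormSq_of_jet_eq_mul {k : ℕ} {F G : ℂ → Fin (n + 1) → ℂ} {z : ℂ}
    {T : Matrix (Fin k) (Fin k) ℂ} (h : jet k G z = T * jet k F z) :
    wedgeNormSq k G z = ‖T.det‖ ^ 2 * wedgeNormSq k F z := by
  have h2 : (jet k G z * (jet k G z)ᴴ).det =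
      ((‖T.det‖ ^ 2 : ℝ) : ℂ) * (jet k F z * (jet k F z)ᴴ).det := by
    rw [h, conjTranspose_mul, Matrix.mul_assoc, ← Matrix.mul_assoc (jet k F z), det_mul, det_mul,
      det_conjTranspose, Complex.ofReal_pow, ← Complex.mul_conj', Complex.star_def]
    ring
  rw [wedgeNormSq_eq_det_jet, h2, Complex.re_ofReal_mul, wedgeNormSq_eq_det_jet]

theorem wedgeNormSq_smul (k : ℕ) {c : ℂ → ℂ} {F : ℂ → Fin (n + 1) → ℂ} {z : ℂ}
    (hc : AnalyticAt ℂ c z) (hF : AnalyticAt ℂ F z) :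
    wedgeNormSq k (fun w => c w • F w) z = ‖c z ^ k‖ ^ 2 * wedgeNormSq k F z := by
  obtain ⟨T, hT, h⟩ := jet_smul k hc hF
  rw [wedgeNormSq_of_jet_eq_mul h, hT]

/-- A linear change of target multiplies the jet on the right, and a unitary factor cancels in the
Gram matrix. -/
theorem wedgeNormSq_mulVec (k : ℕ) {M : Matrix (Fin (n + 1)) (Fin (n + 1)) ℂ}
    (hM : M ∈ Matrix.unitaryGroup (Fin (n + 1)) ℂ) {F : ℂ → Fin (n + 1) → ℂ}
    {z : ℂ} (hF : AnalyticAt ℂ F z) :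
    wedgeNormSq k (fun w => M *ᵥ F w) z = wedgeNormSq k F z := by
  have h : Mᵀ * (Mᵀ)ᴴ = 1 := by
    have := mem_unitaryGroup_iff.1 (transpose_mem_unitaryGroup_iff.2 hM)
    rwa [star_eq_conjTranspose] at this
  rw [wedgeNormSq_eq_det_jet, jet_mulVec _ _ hF, conjTranspose_mul, Matrix.mul_assoc,
    ← Matrix.mul_assoc Mᵀ, h, Matrix.one_mul, wedgeNormSq_eq_det_jet]

theorem wedgeNormSq_congr (k : ℕ) {F G : ℂ → Fin (n + 1) → ℂ} {z : ℂ} (h : F =ᶠ[𝓝 z] G) :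
    wedgeNormSq k F z = wedgeNormSq k G z := by
  rw [wedgeNormSq_eq_det_jet, wedgeNormSq_eq_det_jet, jet_congr k h]

theorem wronskian_congr {F G : ℂ → Fin (n + 1) → ℂ} {z : ℂ} (h : F =ᶠ[𝓝 z] G) :
    wronskian F z = wronskian G z := by
  rw [wronskian_eq_det_jet, wronskian_eq_det_jet, jet_congr _ h]

/-- The jet is square here. This lets the norm formula at `k = n` detect ramification. -/
theorem wedgeNormSq_top (F : ℂ → Fin (n + 1) → ℂ) (z : ℂ) :
    wedgeNormSq (n + 1) F z = ‖wronskian F z‖ ^ 2 := by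
  rw [wedgeNormSq_eq_det_jet, det_mul, det_conjTranspose, Complex.star_def, Complex.mul_conj',
    wronskian_eq_det_jet]
  norm_cast

theorem wedgeNormSq_one (F : ℂ → Fin (n + 1) → ℂ) (z : ℂ) :
    wedgeNormSq 1 F z = ∑ l, ‖F z l‖ ^ 2 := by
  simp only [wedgeNormSq, det_unique, Matrix.of_apply]
  simp only [Fin.default_eq_zero, Fin.coe_ofNat_eq_mod, Nat.zero_mod, iteratedDeriv_zero,
    Complex.re_sum, Complex.mul_conj']
  exact Finset.sum_congr rfl fun l _ => by norm_cast

theorem wedgeNormSq_one_pos {F : ℂ → Fin (n + 1) → ℂ} {z : ℂ} (h : F z ≠ 0) :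
    0 < wedgeNormSq 1 F z := by
  rw [wedgeNormSq_one]
  obtain ⟨l, hl⟩ := Function.ne_iff.1 h
  exact Finset.sum_pos' (fun _ _ => by positivity)
    ⟨l, Finset.mem_univ l, by have := norm_pos_iff.2 hl; positivity⟩

theorem wedgeNormSq_one_eq_dotProduct (F : ℂ → Fin (n + 1) → ℂ) (z : ℂ) :
    ((wedgeNormSq 1 F z : ℝ) : ℂ) = star (F z) ⬝ᵥ F z := by
  rw [wedgeNormSq_one, dotProduct]
  push_cast
  exact Finset.sum_congr rfl fun l _ => by
    rw [Pi.star_apply, Complex.star_def, Complex.conj_mul']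

/-- The jet of a power of a function with a zero. -/
theorem iteratedDeriv_pow_of_eq_zero {g : ℂ → ℂ} {z : ℂ} (hg : AnalyticAt ℂ g z) (h0 : g z = 0)
    (j : ℕ) : (∀ i < j, iteratedDeriv i (g ^ j) z = 0) ∧
      iteratedDeriv j (g ^ j) z = (j.factorial : ℂ) * deriv g z ^ j := by
  induction j with
  | zero => simp
  | succ j ih =>
    have hgj : AnalyticAt ℂ (g ^ j) z := hg.pow j
    constructor
    · intro i hi
      -- In the Leibniz sum for `g * g ^ j`, the term `m = 0` has the factor `g z = 0`; for `m ≥ 1`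
      -- the power is differentiated fewer than `j` times.
      rw [pow_succ', iteratedDeriv_mul hg.contDiffAt hgj.contDiffAt]
      refine Finset.sum_eq_zero fun m hmi => ?_
      have hmi' := Finset.mem_range.1 hmi
      rcases Nat.eq_zero_or_pos m with rfl | hm
      · simp [h0]
      · rcases Nat.lt_or_ge (i - m) j with h | h
        · rw [ih.1 _ h, mul_zero]
        · omega
    -- Only the term `m = 1` survives; its binomial weight `j + 1` completes the factorial.
    · rw [pow_succ', iteratedDeriv_mul hg.contDiffAt hgj.contDiffAt,
        Finset.sum_eq_single 1]
      · rw [Nat.add_sub_cancel, ih.2, iteratedDeriv_one, Nat.choose_one_right,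
          Nat.factorial_succ]
        push_cast
        ring
      · intro m hmi hm
        have hmi' := Finset.mem_range.1 hmi
        rcases Nat.eq_zero_or_pos m with rfl | hm'
        · simp [h0]
        · rw [ih.1 _ (by omega), mul_zero]
      · intro h
        exact absurd (Finset.mem_range.2 (by omega)) h

theorem analyticAt_rationalNormalVec (n : ℕ) {F : ℂ → Fin (1 + 1) → ℂ} {z : ℂ}
    (hF : AnalyticAt ℂ F z) : AnalyticAt ℂ (fun w => rationalNormalVec n (F w)) z := by
  rw [analyticAt_pi_iff]
  intro j
  have h := analyticAt_pi_iff.1 hF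
  exact (analyticAt_const.mul ((h 0).pow _)).mul ((h 1).pow _)

theorem analyticAt_mulVec {m : ℕ} (M : Matrix (Fin m) (Fin m) ℂ) {F : ℂ → Fin m → ℂ} {z : ℂ}
    (hF : AnalyticAt ℂ F z) : AnalyticAt ℂ (fun w => M *ᵥ F w) z :=
  (LinearMap.toContinuousLinearMap (Matrix.mulVecLin M)).analyticAt _ |>.comp hF

/-- The product of the squared norms of the leading coefficients `√(1 / ((n-j)! j!)) j!`. -/
noncomputable def wedgeConst (n k : ℕ) : ℝ :=
  ∏ j : Fin k, (Real.sqrt (1 / ((Nat.factorial (n - (j : ℕ)) : ℝ) * (Nat.factorial (j : ℕ) : ℝ))) *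
    (j : ℕ).factorial) ^ 2

theorem wedgeConst_pos (n k : ℕ) : 0 < wedgeConst n k :=
  Finset.prod_pos fun j _ => by positivity

/-- Osculating norms of `r_n ∘ [F]` at a point where the second coordinate of `F` vanishes. -/
theorem wedgeNormSq_rationalNormalVec_of_eq_zero {k : ℕ} (hk : k ≤ n) {F : ℂ → Fin (1 + 1) → ℂ}
    {z : ℂ} (hF : AnalyticAt ℂ F z) (h0 : F z 0 ≠ 0) (h1 : F z 1 = 0) :
    wedgeNormSq (k + 1) (fun w => rationalNormalVec n (F w)) z =
      wedgeConst n (k + 1) * ‖wronskian F z‖ ^ (k * (k + 1)) *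
        wedgeNormSq 1 F z ^ ((k + 1) * (n - k)) := by
  have hF0 := analyticAt_pi_iff.1 hF 0
  have hF1 := analyticAt_pi_iff.1 hF 1
  -- In the affine lift `(1, g)` the components of `r_n` become multiples of the powers `g ^ j`,
  -- which vanish to order at least `j` at `z`.
  set g : ℂ → ℂ := fun w => F w 1 / F w 0 with hgdef
  have hg : AnalyticAt ℂ g z := hF1.div hF0 h0
  have hg0 : g z = 0 := by simp [hgdef, h1]
  set P : ℂ → Fin (1 + 1) → ℂ := fun w => ![1, g w] with hP
  have hPa : AnalyticAt ℂ P z := by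
    rw [analyticAt_pi_iff]
    intro j
    fin_cases j
    · exact analyticAt_const
    · exact hg
  have hFP : F =ᶠ[𝓝 z] fun w => F w 0 • P w := by
    filter_upwards [hF0.continuousAt.eventually_ne h0] with w hw
    funext j
    fin_cases j
    · simp [hP]
    · simp [hP, hgdef, mul_div_cancel₀ _ hw]
  have hrn : (fun w => rationalNormalVec n (F w)) =ᶠ[𝓝 z]
      fun w => (F w 0) ^ n • rationalNormalVec n (P w) := by
    filter_upwards [hFP] with w hw
    rw [← rationalNormalVec_smul, ← hw]
  have hrP := analyticAt_rationalNormalVec n hPa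
  have hW : wronskian F z = F z 0 ^ 2 * deriv g z := by
    rw [wronskian_congr hFP, wronskian_smul hF0 hPa]
    congr 1
    rw [wronskian, det_fin_two]
    simp only [Matrix.of_apply, iteratedDeriv_apply hPa]
    simp [hP, hg0, iteratedDeriv_one]
  have hN : wedgeNormSq 1 F z = ‖F z 0‖ ^ 2 := by
    rw [wedgeNormSq_one]
    simp [Fin.sum_univ_two, h1]
  let cf : ℕ → ℂ := fun j => ((Real.sqrt
    (1 / ((Nat.factorial (n - j) : ℝ) * (Nat.factorial j : ℝ))) : ℝ) : ℂ)
  have hjet : ∀ (i : ℕ) (j : Fin (n + 1)), iteratedDeriv i (fun w => rationalNormalVec n (P w)) z j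
      = cf j * iteratedDeriv i (g ^ (j : ℕ)) z := by
    intro i j
    rw [iteratedDeriv_apply hrP]
    have : (fun w => rationalNormalVec n (P w) j) = fun w => cf j * (g ^ (j : ℕ)) w := by
      funext w
      simp [rationalNormalVec, hP, cf]
    rw [this, iteratedDeriv_const_mul _ (hg.pow _).contDiffAt]
  -- The jet columns of index greater than `k` vanish, so the Gram matrix comes from this square
  -- block, which is lower triangular.
  let D : Matrix (Fin (k + 1)) (Fin (k + 1)) ℂ :=
    Matrix.of fun i j => cf j * iteratedDeriv i (g ^ (j : ℕ)) z
  have hGram : jet (k + 1) (fun w => rationalNormalVec n (P w)) z *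
      (jet (k + 1) (fun w => rationalNormalVec n (P w)) z)ᴴ = D * Dᴴ := by
    ext a b
    simp only [mul_apply, conjTranspose_apply, jet, Matrix.of_apply, hjet, D]
    rw [← Finset.sum_range (n := n + 1) (fun l => cf l * iteratedDeriv a (g ^ l) z *
        star (cf l * iteratedDeriv b (g ^ l) z)),
      ← Finset.sum_range (n := k + 1) (fun l => cf l * iteratedDeriv a (g ^ l) z *
        star (cf l * iteratedDeriv b (g ^ l) z))]
    refine (Finset.sum_subset (Finset.range_mono (by omega)) fun l _ hl => ?_).symm
    have hl' : k + 1 ≤ l := by simpa using hl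
    rw [(iteratedDeriv_pow_of_eq_zero hg hg0 l).1 a (lt_of_lt_of_le a.2 hl')]
    simp
  have hDdet : D.det = ∏ j : Fin (k + 1), (cf j * ((j : ℕ).factorial * deriv g z ^ (j : ℕ))) := by
    rw [Matrix.det_of_isLowerTriangular]
    · refine Finset.prod_congr rfl fun j _ => ?_
      simp only [D, Matrix.of_apply]
      rw [(iteratedDeriv_pow_of_eq_zero hg hg0 j).2]
    · intro i j hij
      simp only [D, Matrix.of_apply]
      rw [(iteratedDeriv_pow_of_eq_zero hg hg0 j).1 i hij, mul_zero]
  -- The exponent of `deriv g z` in `D.det` is `0 + 1 + ⋯ + k`; squaring the norm doubles it.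
  have hsum : (∑ j : Fin (k + 1), (j : ℕ)) * 2 = k * (k + 1) := by
    rw [← Finset.sum_range (fun j => j), Finset.sum_range_id_mul_two]
    simp [mul_comm]
  have hDn : ‖D.det‖ ^ 2 = wedgeConst n (k + 1) * ‖deriv g z‖ ^ (k * (k + 1)) := by
    rw [hDdet, norm_prod, ← Finset.prod_pow, wedgeConst, ← hsum, pow_mul,
      ← Finset.prod_pow_eq_pow_sum, ← Finset.prod_pow, ← Finset.prod_mul_distrib]
    refine Finset.prod_congr rfl fun j _ => ?_
    have hc : ‖cf j‖ = Real.sqrt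
        (1 / ((Nat.factorial (n - (j : ℕ)) : ℝ) * (Nat.factorial (j : ℕ) : ℝ))) := by
      simp only [cf, Complex.norm_real, Real.norm_eq_abs, abs_of_nonneg (Real.sqrt_nonneg _)]
    rw [norm_mul, norm_mul, norm_pow, hc, Complex.norm_natCast]
    ring
  rw [wedgeNormSq_congr _ hrn, wedgeNormSq_smul (c := fun w => F w 0 ^ n) _ (hF0.fun_pow n) hrP,
    wedgeNormSq_eq_det_jet, hGram,
    det_mul, det_conjTranspose, Complex.star_def, Complex.mul_conj']
  have : (((‖D.det‖ : ℂ)) ^ 2).re = ‖D.det‖ ^ 2 := by norm_cast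
  rw [this, hDn, hW, hN]
  -- With `n = k + d`, the exponents of `‖F z 0‖` match: `2n(k+1) = 2k(k+1) + 2(k+1)d`.
  obtain ⟨d, rfl⟩ := Nat.exists_eq_add_of_le hk
  simp only [Nat.add_sub_cancel_left, norm_mul, norm_pow, mul_pow, ← pow_mul]
  ring

/-- For any nonzero vector of `ℂ²` there is an element of `SU(2)` killing its second coordinate. -/
theorem exists_unitary_mulVec_one_eq_zero {x : Fin (1 + 1) → ℂ} (hx : x ≠ 0) :
    ∃ V ∈ Matrix.unitaryGroup (Fin (1 + 1)) ℂ, V.det = 1 ∧ (V *ᵥ x) 1 = 0 := by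
  have hpos : 0 < ‖x 0‖ ^ 2 + ‖x 1‖ ^ 2 := by
    have := wedgeNormSq_one_pos (F := fun _ => x) (z := 0) hx
    rw [wedgeNormSq_one] at this
    simpa [Fin.sum_univ_two] using this
  set r : ℝ := Real.sqrt (‖x 0‖ ^ 2 + ‖x 1‖ ^ 2) with hr
  have hr0 : (r : ℂ) ≠ 0 := by exact_mod_cast (Real.sqrt_pos.2 hpos).ne'
  have hrr : (r : ℂ) * r = x 0 * star (x 0) + x 1 * star (x 1) := by
    have : r * r = ‖x 0‖ ^ 2 + ‖x 1‖ ^ 2 := Real.mul_self_sqrt hpos.le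
    rw [Complex.star_def, Complex.mul_conj', Complex.mul_conj']
    exact_mod_cast this
  have hsr : star (r : ℂ) = r := Complex.conj_ofReal r
  -- The first row is the conjugate of the unit vector `x / r`; the second is the unit row that
  -- annihilates `x`.
  refine ⟨!![star (x 0) / r, star (x 1) / r; -(x 1) / r, x 0 / r], ?_, ?_, ?_⟩
  · rw [mem_unitaryGroup_iff]
    ext i j
    fin_cases i <;> fin_cases j <;>
      simp only [mul_apply, Fin.sum_univ_two, star_apply, Matrix.of_apply, one_apply] <;> simp <;> field_simp <;>
      simp only [Complex.star_def] at * <;> first | ring1 | linear_combination -hrr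
  · rw [det_fin_two_of]
    field_simp
    linear_combination -hrr
  · simp [mulVec, dotProduct, Fin.sum_univ_two]
    ring

/-- The norms of the osculating curves of the rational normal curve. -/
theorem wedgeNormSq_rationalNormalVec {k : ℕ} (hk : k ≤ n) {F : ℂ → Fin (1 + 1) → ℂ}
    {z : ℂ} (hF : AnalyticAt ℂ F z) (h0 : F z ≠ 0) :
    wedgeNormSq (k + 1) (fun w => rationalNormalVec n (F w)) z =
      wedgeConst n (k + 1) * ‖wronskian F z‖ ^ (k * (k + 1)) *
        wedgeNormSq 1 F z ^ ((k + 1) * (n - k)) := by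
  -- Both sides are invariant under a constant `V` of determinant 1, the left one because `r_n`
  -- turns `V` into a unitary `M`; so the second coordinate may be assumed to vanish at `z`.
  obtain ⟨V, hV, hdet, hx⟩ := exists_unitary_mulVec_one_eq_zero h0
  obtain ⟨M, hM, hMV⟩ := exists_unitary_rationalNormalVec n hV
  have hne : V *ᵥ F z ≠ 0 := by
    intro h
    apply h0
    have : star V *ᵥ (V *ᵥ F z) = star V *ᵥ 0 := by rw [h]
    rwa [mulVec_mulVec, mem_unitaryGroup_iff'.1 hV, one_mulVec, mulVec_zero] at this
  have h := wedgeNormSq_rationalNormalVec_of_eq_zero hk (analyticAt_mulVec V hF)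
    (fun h => hne (by
      funext j
      fin_cases j
      · exact h
      · exact hx)) hx
  rw [wedgeNormSq_mulVec 1 hV hF, wronskian_mulVec V hF, hdet, one_mul] at h
  rw [← h]
  simp only [hMV]
  rw [wedgeNormSq_mulVec _ hM (analyticAt_rationalNormalVec n hF)]

end Jets

end Toda

namespace Toda

/-! ### Polarization, curvature of osculating curves, Calabi rigidity -/

section Rigidity

open Matrix InnerProductSpace

/-- The real zeros accumulate at the centre, so the identity theorem applies. -/
theorem eqOn_zero_of_forall_ofReal {h : ℂ → ℂ} {s : ℝ} (hs : 0 < s)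
    (hh : DifferentiableOn ℂ h (Metric.ball 0 s)) (h0 : ∀ t : ℝ, |t| < s → h t = 0) :
    ∀ x ∈ Metric.ball (0 : ℂ) s, h x = 0 := by
  refine (hh.analyticOnNhd Metric.isOpen_ball).eqOn_zero_of_preconnected_of_frequently_eq_zero
    (convex_ball 0 s).isPreconnected (Metric.mem_ball_self hs) ?_
  have ht : Filter.Tendsto (fun t : ℝ => (t : ℂ)) (𝓝[≠] 0) (𝓝[≠] 0) := by
    refine tendsto_nhdsWithin_iff.2 ⟨?_, ?_⟩
    · exact (Complex.continuous_ofReal.tendsto' 0 0 (by simp)).mono_left nhdsWithin_le_nhds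
    · filter_upwards [self_mem_nhdsWithin] with t ht
      exact fun h => ht (by simpa using h)
  refine ht.frequently (Filter.Eventually.frequently ?_)
  have : ∀ᶠ t : ℝ in 𝓝 0, |t| < s := by
    have := Metric.ball_mem_nhds (0 : ℝ) hs
    filter_upwards [this] with t ht
    simpa using ht
  filter_upwards [nhdsWithin_le_nhds this] with t ht using h0 t ht

/-- Conjugating both argument and value restores holomorphy. In the polarization this handles the
conjugated factor of the Hermitian product. -/
theorem differentiableAt_star_comp_star {f : ℂ → ℂ} {x : ℂ} (hf : DifferentiableAt ℂ f (star x)) :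
    DifferentiableAt ℂ (fun w => star (f (star w))) x := by
  have := hf.star_star
  rw [star_star] at this
  exact this

/-- Polarization: holomorphic maps with equal norms have equal Gram functions. -/
theorem dotProduct_eq_of_norm_eq {m : ℕ} {F K : ℂ → Fin m → ℂ} {z₀ : ℂ} {r : ℝ}
    (hF : AnalyticOnNhd ℂ F (Metric.ball z₀ r)) (hK : AnalyticOnNhd ℂ K (Metric.ball z₀ r))
    (h : ∀ z ∈ Metric.ball z₀ r, star (F z) ⬝ᵥ F z = star (K z) ⬝ᵥ K z) {z w : ℂ}
    (hz : z ∈ Metric.ball z₀ (r / 2)) (hw : w ∈ Metric.ball z₀ (r / 2)) :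
    star (F z) ⬝ᵥ F w = star (K z) ⬝ᵥ K w := by
  have hr : 0 < r / 2 := lt_of_le_of_lt dist_nonneg (Metric.mem_ball.1 hz)
  have key : ∀ {J : ℂ → Fin m → ℂ}, AnalyticOnNhd ℂ J (Metric.ball z₀ r) → ∀ p q,
      ‖p‖ < r → ‖q‖ < r → ∀ l,
      DifferentiableAt ℂ (fun p => J (z₀ + p) l) p ∧
        DifferentiableAt ℂ (fun q => star (J (z₀ + star q) l)) q := by
    intro J hJ p q hp hq l
    have hd : ∀ v, ‖v‖ < r → DifferentiableAt ℂ (fun v => J (z₀ + v) l) v := by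
      intro v hv
      have h1 : DifferentiableAt ℂ J (z₀ + v) :=
        (hJ _ (by simpa [dist_eq_norm] using hv)).differentiableAt
      have h2 := differentiableAt_pi.1 h1 l
      exact h2.comp v (by fun_prop)
    refine ⟨hd p hp, differentiableAt_star_comp_star (f := fun v => J (z₀ + v) l) (hd _ ?_)⟩
    rwa [norm_star]
  -- The real coordinates `x, y` of the point are made complex. For real `x, y` both factors are
  -- evaluated at `z₀ + x + I y`, where the norms agree; `g` is holomorphic in each variable, so it
  -- vanishes in one variable after the other.
  let g : ℂ → ℂ → ℂ := fun x y =>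
    ∑ l, (star (F (z₀ + star (x - Complex.I * y)) l) * F (z₀ + (x + Complex.I * y)) l -
      star (K (z₀ + star (x - Complex.I * y)) l) * K (z₀ + (x + Complex.I * y)) l)
  have hnorm : ∀ x y : ℂ, ‖x‖ < r / 2 → ‖y‖ < r / 2 →
      ‖x + Complex.I * y‖ < r ∧ ‖x - Complex.I * y‖ < r := by
    intro x y hx hy
    have h1 : ‖Complex.I * y‖ = ‖y‖ := by simp
    exact ⟨by linarith [norm_add_le x (Complex.I * y)], by linarith [norm_sub_le x (Complex.I * y)]⟩
  have hgx : ∀ x y : ℂ, ‖x‖ < r / 2 → ‖y‖ < r / 2 →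
      DifferentiableAt ℂ (fun x => g x y) x ∧ DifferentiableAt ℂ (fun y => g x y) y := by
    intro x y hx hy
    obtain ⟨hp, hq⟩ := hnorm x y hx hy
    constructor
    · refine DifferentiableAt.fun_sum fun l _ => ?_
      obtain ⟨hF1, hF2⟩ := key hF _ _ hp hq l
      obtain ⟨hK1, hK2⟩ := key hK _ _ hp hq l
      exact ((hF2.comp x (f := fun x => x - Complex.I * y) (by fun_prop)).mul
        (hF1.comp x (f := fun x => x + Complex.I * y) (by fun_prop))).sub
        ((hK2.comp x (f := fun x => x - Complex.I * y) (by fun_prop)).mul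
        (hK1.comp x (f := fun x => x + Complex.I * y) (by fun_prop)))
    · refine DifferentiableAt.fun_sum fun l _ => ?_
      obtain ⟨hF1, hF2⟩ := key hF _ _ hp hq l
      obtain ⟨hK1, hK2⟩ := key hK _ _ hp hq l
      exact ((hF2.comp y (f := fun y => x - Complex.I * y) (by fun_prop)).mul
        (hF1.comp y (f := fun y => x + Complex.I * y) (by fun_prop))).sub
        ((hK2.comp y (f := fun y => x - Complex.I * y) (by fun_prop)).mul
        (hK1.comp y (f := fun y => x + Complex.I * y) (by fun_prop)))
  have hgreal : ∀ s t : ℝ, |s| < r / 2 → |t| < r / 2 → g s t = 0 := by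
    intro s t hs ht
    have hst : star ((s : ℂ) - Complex.I * t) = s + Complex.I * t := by
      simp
    have hmem : z₀ + ((s : ℂ) + Complex.I * t) ∈ Metric.ball z₀ r := by
      have := (hnorm s t (by simpa using hs) (by simpa using ht)).1
      simpa [dist_eq_norm] using this
    have := h _ hmem
    simp only [dotProduct, Pi.star_apply] at this
    simp only [g, hst, Finset.sum_sub_distrib, this, sub_self]
  have hg1 : ∀ t : ℝ, |t| < r / 2 → ∀ x, ‖x‖ < r / 2 → g x t = 0 := by
    intro t ht x hx
    refine eqOn_zero_of_forall_ofReal hr (h := fun x => g x t) (fun y hy => ?_)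
      (fun s hs => hgreal s t hs ht) x (by simpa using hx)
    exact (hgx y t (by simpa using hy) (by simpa using ht)).1.differentiableWithinAt
  have hg2 : ∀ x y, ‖x‖ < r / 2 → ‖y‖ < r / 2 → g x y = 0 := by
    intro x y hx hy
    refine eqOn_zero_of_forall_ofReal hr (h := fun y => g x y) (fun y hy => ?_)
      (fun t ht => hg1 t ht x hx) y (by simpa using hy)
    exact (hgx x y hx (by simpa using hy)).2.differentiableWithinAt
  have hz' : ‖star (z - z₀)‖ < r / 2 := by
    rw [norm_star]; simpa [dist_eq_norm] using hz
  have hw' : ‖w - z₀‖ < r / 2 := by simpa [dist_eq_norm] using hw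
  have hI : Complex.I ≠ 0 := Complex.I_ne_zero
  -- These arguments solve `x + I y = w - z₀` and `x - I y = star (z - z₀)`. Halving the radius
  -- keeps both of norm less than `r / 2`.
  have := hg2 ((w - z₀ + star (z - z₀)) / 2) ((w - z₀ - star (z - z₀)) / (2 * Complex.I)) ?_ ?_
  · have e1 : (w - z₀ + star (z - z₀)) / 2 -
        Complex.I * ((w - z₀ - star (z - z₀)) / (2 * Complex.I)) = star (z - z₀) := by
      field_simp; ring
    have e2 : (w - z₀ + star (z - z₀)) / 2 +
        Complex.I * ((w - z₀ - star (z - z₀)) / (2 * Complex.I)) = w - z₀ := by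
      field_simp; ring
    simp only [g, e1, e2, star_star, add_sub_cancel, Finset.sum_sub_distrib] at this
    exact sub_eq_zero.1 this
  · rw [norm_div, Complex.norm_ofNat]
    linarith [norm_add_le (w - z₀) (star (z - z₀))]
  · rw [norm_div, norm_mul, Complex.norm_ofNat, Complex.norm_I, mul_one]
    linarith [norm_sub_le (w - z₀) (star (z - z₀))]

variable {n : ℕ}

theorem contDiffAt_log_wedgeNormSq_one {F : ℂ → Fin (n + 1) → ℂ} {z : ℂ} (hF : AnalyticAt ℂ F z)
    (h0 : F z ≠ 0) : ContDiffAt ℝ 2 (fun w => Real.log (wedgeNormSq 1 F w)) z := by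
  refine ContDiffAt.log ?_ (wedgeNormSq_one_pos h0).ne'
  rw [funext fun w => wedgeNormSq_one F w]
  refine ContDiffAt.sum fun l _ => ?_
  have h1 : ContDiffAt ℂ 2 (fun w => F w l) z := (analyticAt_pi_iff.1 hF l).contDiffAt
  exact (h1.restrict_scalars ℝ).norm_sq ℝ

theorem analyticAt_wronskian {F : ℂ → Fin (1 + 1) → ℂ} {z : ℂ} (hF : AnalyticAt ℂ F z) :
    AnalyticAt ℂ (wronskian F) z := by
  have h : ∀ i j, AnalyticAt ℂ (fun w => iteratedDeriv i F w j) z := fun i j => by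
    have : AnalyticAt ℂ (iteratedDeriv i F) z := by
      rw [iteratedDeriv_eq_iterate]
      exact hF.iterated_deriv i
    exact analyticAt_pi_iff.1 this j
  have : wronskian F = fun z => iteratedDeriv 0 F z 0 * iteratedDeriv 1 F z 1 -
      iteratedDeriv 0 F z 1 * iteratedDeriv 1 F z 0 := by
    funext z
    rw [wronskian, det_fin_two]
    rfl
  rw [this]
  exact ((h 0 0).mul (h 1 1)).sub ((h 0 1).mul (h 1 0))

/-- The curvature of the osculating curves of the rational normal curve. -/
theorem laplacian_log_wedgeNormSq {k : ℕ} (hk : k ≤ n) {F : ℂ → Fin (1 + 1) → ℂ} {z : ℂ}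
    (hF : AnalyticAt ℂ F z) (h0 : F z ≠ 0) (hW : wronskian F z ≠ 0) {c : ℂ → ℂ}
    (hc : AnalyticAt ℂ c z) (hc0 : c z ≠ 0) {U : Matrix (Fin (n + 1)) (Fin (n + 1)) ℂ}
    (hU : U ∈ Matrix.unitaryGroup (Fin (n + 1)) ℂ) {G : ℂ → Fin (n + 1) → ℂ}
    (hG : G =ᶠ[𝓝 z] fun w => c w • (U *ᵥ rationalNormalVec n (F w))) :
    wedgeNormSq (k + 1) G z ≠ 0 ∧
    Laplacian.laplacian (fun w => Real.log (wedgeNormSq (k + 1) G w)) z =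
      (((k + 1) * (n - k) : ℕ) : ℝ) *
        Laplacian.laplacian (fun w => Real.log (wedgeNormSq 1 F w)) z := by
  have hWa := analyticAt_wronskian hF
  have hev : ∀ᶠ w in 𝓝 z, 0 < wedgeConst n (k + 1) ∧ c w ≠ 0 ∧ wronskian F w ≠ 0 ∧
      0 < wedgeNormSq 1 F w ∧
      wedgeNormSq (k + 1) G w = ‖c w ^ (k + 1)‖ ^ 2 * (wedgeConst n (k + 1) *
        ‖wronskian F w ^ (k * (k + 1))‖ * wedgeNormSq 1 F w ^ ((k + 1) * (n - k))) := by
    filter_upwards [hF.eventually_analyticAt, hc.eventually_analyticAt,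
      hF.continuousAt.eventually_ne h0, hc.continuousAt.eventually_ne hc0,
      hWa.continuousAt.eventually_ne hW, hG.eventuallyEq_nhds] with w hFw hcw h0w hc0w hWw hGw
    refine ⟨wedgeConst_pos _ _, hc0w, hWw, wedgeNormSq_one_pos h0w, ?_⟩
    rw [wedgeNormSq_congr _ hGw, wedgeNormSq_smul _ hcw
      (analyticAt_mulVec U (analyticAt_rationalNormalVec n hFw)),
      wedgeNormSq_mulVec _ hU (analyticAt_rationalNormalVec n hFw),
      wedgeNormSq_rationalNormalVec hk hFw h0w, norm_pow (wronskian F w)]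
  constructor
  · obtain ⟨h1, h2, h3, h4, h5⟩ := hev.self_of_nhds
    rw [h5]
    have := norm_pos_iff.2 (pow_ne_zero (k + 1) h2)
    have := norm_pos_iff.2 (pow_ne_zero (k * (k + 1)) h3)
    positivity
  · set e : ℕ := (k + 1) * (n - k) with he
    set ψ : ℂ → ℝ := fun w => Real.log (wedgeNormSq 1 F w) with hψ
    -- `H` gathers the logarithms of moduli of nonvanishing holomorphic functions and a constant. It
    -- is harmonic, so only the power of `‖F‖²` contributes to the Laplacian.
    set H : ℂ → ℝ := ((2 : ℝ) • (fun w => Real.log ‖(fun w => c w ^ (k + 1)) w‖) +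
      fun _ => Real.log (wedgeConst n (k + 1))) +
        fun w => Real.log ‖(fun w => wronskian F w ^ (k * (k + 1))) w‖ with hH
    have hHarm : HarmonicAt H z :=
      (((AnalyticAt.harmonicAt_log_norm (hc.fun_pow (k + 1)) (pow_ne_zero _ hc0)).const_smul).add
        (harmonicAt_const _)).add
        (AnalyticAt.harmonicAt_log_norm (hWa.fun_pow _) (pow_ne_zero _ hW))
    have hψd : ContDiffAt ℝ 2 ψ z := contDiffAt_log_wedgeNormSq_one hF h0
    have hsd : ContDiffAt ℝ 2 ((e : ℝ) • ψ) z := hψd.const_smul (e : ℝ)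
    have heq : (fun w => Real.log (wedgeNormSq (k + 1) G w)) =ᶠ[𝓝 z] H + (e : ℝ) • ψ := by
      filter_upwards [hev] with w ⟨h1, h2, h3, h4, h5⟩
      have h6 := norm_pos_iff.2 (pow_ne_zero (k + 1) h2)
      have h7 := norm_pos_iff.2 (pow_ne_zero (k * (k + 1)) h3)
      rw [h5, Real.log_mul (by positivity) (by positivity),
        Real.log_mul (by positivity) (by positivity), Real.log_mul (by positivity) (by positivity),
        Real.log_pow, Real.log_pow]
      simp only [hH, hψ, Pi.add_apply, Pi.smul_apply, smul_eq_mul]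
      push_cast
      ring
    rw [(laplacian_congr_nhds heq).self_of_nhds, ContDiffAt.laplacian_add hHarm.1
      hsd, hHarm.2.self_of_nhds, laplacian_smul _ hψd]
    simp

/-- Calabi's rigidity for holomorphic maps to projective space inducing the same Fubini–Study
form. -/
theorem exists_specialUnitary_of_laplacian_eq {G H : ℂ → Fin (n + 1) → ℂ} {z₀ : ℂ}
    (hG : AnalyticAt ℂ G z₀) (hH : AnalyticAt ℂ H z₀) (hG0 : G z₀ ≠ 0) (hH0 : H z₀ ≠ 0)
    (h : ∀ᶠ w in 𝓝 z₀, Laplacian.laplacian (fun w => Real.log (wedgeNormSq 1 G w)) w =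
      Laplacian.laplacian (fun w => Real.log (wedgeNormSq 1 H w)) w) :
    ∃ U : Matrix.specialUnitaryGroup (Fin (n + 1)) ℂ, ∀ᶠ w in 𝓝 z₀, ∃ c : ℂ, c ≠ 0 ∧
      G w = c • ((U : Matrix (Fin (n + 1)) (Fin (n + 1)) ℂ) *ᵥ H w) := by
  have hgd := contDiffAt_log_wedgeNormSq_one hG hG0
  have hhd := contDiffAt_log_wedgeNormSq_one hH hH0
  have hharm : HarmonicAt ((fun w => Real.log (wedgeNormSq 1 G w)) -
      fun w => Real.log (wedgeNormSq 1 H w)) z₀ := by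
    refine ⟨hgd.sub hhd, ?_⟩
    filter_upwards [h, hgd.laplacian_sub_nhds hhd] with w h1 h2
    rw [h2, Pi.sub_apply, h1, sub_self, Pi.zero_apply]
  obtain ⟨r, hr, hball⟩ := Metric.eventually_nhds_iff_ball.1 (hharm.eventually.and
    (hG.eventually_analyticAt.and (hH.eventually_analyticAt.and
      ((hG.continuousAt.eventually_ne hG0).and (hH.continuousAt.eventually_ne hH0)))))
  obtain ⟨f, hf, hre⟩ := HarmonicOnNhd.exists_analyticOnNhd_ball_re_eq (z := z₀) (R := r)
    fun w hw => (hball w hw).1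
  -- The difference of the log norms is `Re f`. Rescaling the lift by `exp (f / 2)` multiplies its
  -- squared norm by `exp (Re f)`, so `K` and `G` have equal norms.
  let K : ℂ → Fin (n + 1) → ℂ := fun w => Complex.exp (f w / 2) • H w
  have hK : AnalyticOnNhd ℂ K (Metric.ball z₀ r) := fun w hw =>
    ((hf w hw).div analyticAt_const two_ne_zero).cexp.smul (hball w hw).2.2.1
  have hGK : ∀ w ∈ Metric.ball z₀ r, star (G w) ⬝ᵥ G w = star (K w) ⬝ᵥ K w := by
    intro w hw
    obtain ⟨-, -, -, hGw, hHw⟩ := hball w hw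
    have h1 := hre hw
    have hGp := wedgeNormSq_one_pos hGw
    have hHp := wedgeNormSq_one_pos hHw
    have h2 : wedgeNormSq 1 G w = Real.exp (f w).re * wedgeNormSq 1 H w := by
      simp only [Pi.sub_apply] at h1
      rw [h1, Real.exp_sub, Real.exp_log hGp, Real.exp_log hHp, div_mul_cancel₀ _ hHp.ne']
    have h3 : wedgeNormSq 1 K w = Real.exp (f w).re * wedgeNormSq 1 H w := by
      simp only [wedgeNormSq_one, K, Pi.smul_apply, smul_eq_mul, norm_mul, mul_pow,
        Complex.norm_exp, ← Finset.mul_sum]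
      congr 1
      rw [← Real.exp_nat_mul]
      congr 1
      have : (f w / 2).re = (f w).re / 2 := by
        simp
      rw [this]
      push_cast
      ring
    rw [← wedgeNormSq_one_eq_dotProduct, ← wedgeNormSq_one_eq_dotProduct, h2, h3]
  obtain ⟨U, c, hc, hU⟩ := exists_specialUnitary_of_gram_eq
    (fun w : Metric.ball z₀ (r / 2) => K w) (fun w => G w) fun z w =>
      (dotProduct_eq_of_norm_eq (fun w hw => (hball w hw).2.1) hK hGK z.2 w.2).symm
  refine ⟨U, ?_⟩
  filter_upwards [Metric.ball_mem_nhds z₀ (half_pos hr)] with w hw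
  refine ⟨c * Complex.exp (f w / 2), mul_ne_zero hc (Complex.exp_ne_zero _), ?_⟩
  rw [hU ⟨w, hw⟩]
  simp only [K, mulVec_smul, smul_smul]

end Rigidity

end Toda

namespace Toda

/-! ### Germs and post-composition -/

section GermLemmas

variable {S : Type*} [TopologicalSpace S] {Y Z W : Type*}

theorem germAt_eq_iff {h h' : S → Y} {x : S} : germAt h x = germAt h' x ↔ h =ᶠ[𝓝 x] h' := by
  simp [germAt, Sigma.mk.injEq, Filter.Germ.coe_eq]

theorem exists_eq_germAt (p : GermAt S Y) : ∃ h, p = germAt h p.1 := by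
  obtain ⟨x, g⟩ := p
  induction g using Filter.Germ.inductionOn with
  | _ h => exact ⟨h, rfl⟩

theorem post_germAt (φ : Y → Z) (h : S → Y) (x : S) :
    (germAt h x).post φ = germAt (φ ∘ h) x := rfl

theorem post_post (φ : Y → Z) (χ : Z → W) (p : GermAt S Y) :
    (p.post φ).post χ = p.post (χ ∘ φ) := by
  obtain ⟨h, hp⟩ := exists_eq_germAt p
  rw [hp]
  rfl

theorem IsContinuation.post {Γ : unitInterval → GermAt S Y} (hΓ : IsContinuation Γ) (φ : Y → Z) :
    IsContinuation fun t => (Γ t).post φ := by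
  refine ⟨hΓ.1, fun t => ?_⟩
  obtain ⟨h, hh⟩ := hΓ.2 t
  refine ⟨φ ∘ h, hh.mono fun s hs => ?_⟩
  change (Γ s).post φ = germAt (φ ∘ h) (Γ s).1
  rw [← post_germAt, ← hs]

end GermLemmas

/-! ### Local lifts and uniqueness of analytic continuation -/

section Lifts

open Matrix

/-- Proportionality is the vanishing of the 2×2 minors. For lifts these are holomorphic functions,
to which the identity theorem applies. -/
theorem mk_eq_mk_iff_mul {m : ℕ} {v w : Fin m → ℂ} (hv : v ≠ 0) (hw : w ≠ 0) :
    Projectivization.mk ℂ v hv = Projectivization.mk ℂ w hw ↔ ∀ i j, v i * w j = v j * w i := by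
  rw [Projectivization.mk_eq_mk_iff']
  constructor
  · rintro ⟨a, rfl⟩ i j
    simp only [Pi.smul_apply, smul_eq_mul]
    ring
  · intro h
    obtain ⟨j, hj⟩ := Function.ne_iff.1 hw
    have hj' : w j ≠ 0 := hj
    refine ⟨v j / w j, ?_⟩
    funext i
    rw [Pi.smul_apply, smul_eq_mul, div_mul_eq_mul_div, ← h i j, mul_div_cancel_right₀ _ hj']

variable {S : Type*} [TopologicalSpace S] {n : ℕ}

theorem isLift_germAt_iff {e : OpenPartialHomeomorph S ℂ} {h : S → CP n} {x : S}
    {F : ℂ → Fin (n + 1) → ℂ} :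
    IsLift e (germAt h x) F ↔ AnalyticAt ℂ F (e x) ∧
      ∀ᶠ y in 𝓝 x, ∃ hy : F (e y) ≠ 0, h y = Projectivization.mk ℂ (F (e y)) hy := by
  constructor
  · rintro ⟨ha, h', hp, hl⟩
    refine ⟨ha, ?_⟩
    have hp' : h =ᶠ[𝓝 x] h' := germAt_eq_iff.1 hp
    filter_upwards [hp', hl] with y h1 ⟨hy, h2⟩ using ⟨hy, h1.trans h2⟩
  · rintro ⟨ha, hl⟩
    exact ⟨ha, h, rfl, hl⟩

theorem eventually_nhds_chart {e : OpenPartialHomeomorph S ℂ} {x : S} (hx : x ∈ e.source)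
    {P : ℂ → Prop} : (∀ᶠ y in 𝓝 x, P (e y)) ↔ ∀ᶠ z in 𝓝 (e x), P z := by
  rw [← e.map_nhds_eq hx, Filter.eventually_map]

theorem IsLift.ne_zero {e : OpenPartialHomeomorph S ℂ} {p : GermAt S (CP n)}
    {F : ℂ → Fin (n + 1) → ℂ} (hF : IsLift e p F) : F (e p.1) ≠ 0 := by
  obtain ⟨_, _, h⟩ := hF.lifts
  exact h.self_of_nhds.choose

theorem IsLift.eventually {e : OpenPartialHomeomorph S ℂ} {h : S → CP n} {x : S}
    (hx : x ∈ e.source) {F : ℂ → Fin (n + 1) → ℂ} (hF : IsLift e (germAt h x) F) :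
    ∀ᶠ y in 𝓝 x, IsLift e (germAt h y) F := by
  obtain ⟨ha, hl⟩ := isLift_germAt_iff.1 hF
  filter_upwards [(eventually_nhds_chart hx).2 ha.eventually_analyticAt,
    hl.eventually_nhds] with y h1 h2 using isLift_germAt_iff.2 ⟨h1, h2⟩

/-- Two local lifts of the same germ differ by a nonvanishing holomorphic factor. -/
theorem IsLift.exists_eq_smul {e : OpenPartialHomeomorph S ℂ} {p : GermAt S (CP n)}
    (hp : p.1 ∈ e.source) {F G : ℂ → Fin (n + 1) → ℂ} (hF : IsLift e p F) (hG : IsLift e p G) :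
    ∃ c : ℂ → ℂ, AnalyticAt ℂ c (e p.1) ∧ c (e p.1) ≠ 0 ∧
      G =ᶠ[𝓝 (e p.1)] fun w => c w • F w := by
  obtain ⟨h, hph⟩ := exists_eq_germAt p
  rw [hph] at hF hG
  obtain ⟨hFa, hFl⟩ := isLift_germAt_iff.1 hF
  obtain ⟨hGa, hGl⟩ := isLift_germAt_iff.1 hG
  have hFG : ∀ᶠ w in 𝓝 (e p.1), G w ≠ 0 ∧ ∀ i j, G w i * F w j = G w j * F w i := by
    rw [← eventually_nhds_chart hp]
    filter_upwards [hFl, hGl] with y ⟨h1, h2⟩ ⟨h3, h4⟩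
    exact ⟨h3, (mk_eq_mk_iff_mul h3 h1).1 (h4.symm.trans h2)⟩
  have hF0 : F (e p.1) ≠ 0 := hF.ne_zero
  obtain ⟨j, hj⟩ := Function.ne_iff.1 hF0
  have hj' : F (e p.1) j ≠ 0 := hj
  have hFj := analyticAt_pi_iff.1 hFa j
  have heq : G =ᶠ[𝓝 (e p.1)] fun w => (G w j / F w j) • F w := by
    filter_upwards [hFG, hFj.continuousAt.eventually_ne hj'] with w ⟨_, hw⟩ hwj
    funext i
    rw [Pi.smul_apply, smul_eq_mul, div_mul_eq_mul_div, ← hw i j, mul_div_cancel_right₀ _ hwj]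
  refine ⟨fun w => G w j / F w j, (analyticAt_pi_iff.1 hGa j).div hFj hj', fun h0 => ?_, heq⟩
  have h1 := heq.self_of_nhds
  simp only [h0, zero_smul] at h1
  exact hFG.self_of_nhds.1 h1

/-- The identity theorem for germs of holomorphic maps to projective space. -/
theorem eventually_germAt_eq_iff {e : OpenPartialHomeomorph S ℂ} {x : S} (hx : x ∈ e.source)
    {h h' : S → CP n} {F F' : ℂ → Fin (n + 1) → ℂ} (hF : IsLift e (germAt h x) F)
    (hF' : IsLift e (germAt h' x) F') :
    ∀ᶠ y in 𝓝 x, (germAt h y = germAt h' y ↔ germAt h x = germAt h' x) := by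
  obtain ⟨hFa, hFl⟩ := isLift_germAt_iff.1 hF
  obtain ⟨hFa', hFl'⟩ := isLift_germAt_iff.1 hF'
  obtain ⟨r, hr, hball⟩ := Metric.eventually_nhds_iff_ball.1
    (hFa.eventually_analyticAt.and hFa'.eventually_analyticAt)
  have hgood := (hFl.and hFl').and ((eventually_nhds_chart hx).2 (Metric.ball_mem_nhds (e x) hr))
  filter_upwards [hgood.eventually_nhds, e.open_source.mem_nhds hx] with y hy hys
  have hmul : ∀ᶠ z in 𝓝 y, (h z = h' z ↔ ∀ i j, F (e z) i * F' (e z) j =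
      F (e z) j * F' (e z) i) := by
    filter_upwards [hy] with z ⟨⟨⟨h1, h2⟩, ⟨h3, h4⟩⟩, _⟩
    rw [h2, h4, mk_eq_mk_iff_mul]
  have hmulx : ∀ᶠ z in 𝓝 x, (h z = h' z ↔ ∀ i j, F (e z) i * F' (e z) j =
      F (e z) j * F' (e z) i) := by
    filter_upwards [hgood] with z ⟨⟨⟨h1, h2⟩, ⟨h3, h4⟩⟩, _⟩
    rw [h2, h4, mk_eq_mk_iff_mul]
  -- Equality of germs at any such point is equivalent to one condition independent of the point:
  -- the minors vanish on the whole ball.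
  have hprop : ∀ y ∈ e.source, e y ∈ Metric.ball (e x) r →
      (∀ᶠ z in 𝓝 y, (h z = h' z ↔ ∀ i j, F (e z) i * F' (e z) j = F (e z) j * F' (e z) i)) →
      (germAt h y = germAt h' y ↔ ∀ w ∈ Metric.ball (e x) r, ∀ i j,
        F w i * F' w j = F w j * F' w i) := by
    intro y hys hyb hmul
    rw [germAt_eq_iff]
    constructor
    · intro heq w hw i j
      have hz : ∀ᶠ z in 𝓝 (e y), F z i * F' z j - F z j * F' z i = 0 := by
        rw [← eventually_nhds_chart hys (P := fun z => F z i * F' z j - F z j * F' z i = 0)]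
        filter_upwards [heq, hmul] with z h1 h2
        rw [h2.1 h1 i j, sub_self]
      have han : AnalyticOnNhd ℂ (fun z => F z i * F' z j - F z j * F' z i)
          (Metric.ball (e x) r) := fun w hw => by
        have h1 := analyticAt_pi_iff.1 (hball w hw).1
        have h2 := analyticAt_pi_iff.1 (hball w hw).2
        exact ((h1 i).mul (h2 j)).sub ((h1 j).mul (h2 i))
      exact sub_eq_zero.1 (han.eqOn_zero_of_preconnected_of_eventuallyEq_zero
        (convex_ball _ _).isPreconnected hyb hz hw)
    · intro hall
      filter_upwards [hmul, (eventually_nhds_chart hys).2 (Metric.isOpen_ball.mem_nhds hyb)]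
        with z h1 h2 using h1.2 (hall _ h2)
  rw [hprop y hys hy.self_of_nhds.2 hmul, hprop x hx (Metric.mem_ball_self hr) hmulx]

variable [ChartedSpace ℂ S]

/-- Germs of holomorphic maps. -/
def IsHolomorphicGerm (p : GermAt S (CP n)) : Prop := ∃ F, IsLift (chartAt ℂ p.1) p F

theorem IsMultivaluedCurve.isHolomorphicGerm {f : Set (GermAt S (CP n))}
    (hf : IsMultivaluedCurve f) {p : GermAt S (CP n)} (hp : p ∈ f) : IsHolomorphicGerm p :=
  hf.holomorphic p hp _ (chart_mem_atlas ℂ p.1) (mem_chart_source ℂ p.1)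

/-- Uniqueness of analytic continuation. -/
theorem IsContinuation.eq_of_eq_zero {Γ Γ' : unitInterval → GermAt S (CP n)}
    (hΓ : IsContinuation Γ) (hΓ' : IsContinuation Γ') (hol : ∀ t, IsHolomorphicGerm (Γ t))
    (hol' : ∀ t, IsHolomorphicGerm (Γ' t)) (hb : ∀ t, (Γ' t).1 = (Γ t).1) (h0 : Γ 0 = Γ' 0)
    (t : unitInterval) : Γ t = Γ' t := by
  -- Agreement of the two continuations is locally constant in time, hence holds on a clopen subset
  -- of the interval.
  have key : ∀ t, ∀ᶠ s in 𝓝 t, (Γ s = Γ' s ↔ Γ t = Γ' t) := by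
    intro t
    obtain ⟨h, hh⟩ := hΓ.2 t
    obtain ⟨h', hh'⟩ := hΓ'.2 t
    simp only [hb] at hh'
    obtain ⟨F, hF⟩ := hol t
    obtain ⟨F', hF'⟩ := hol' t
    rw [hb t, hh'.self_of_nhds] at hF'
    rw [hh.self_of_nhds] at hF
    have h1 := hΓ.1.continuousAt.eventually
      (eventually_germAt_eq_iff (mem_chart_source ℂ (Γ t).1) hF hF')
    filter_upwards [h1, hh, hh'] with s h2 h3 h4
    rw [h3, h4, h2, ← hh.self_of_nhds, ← hh'.self_of_nhds]
  have hclopen : IsClopen {t | Γ t = Γ' t} := by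
    refine ⟨⟨isOpen_iff_mem_nhds.2 fun t ht => ?_⟩, isOpen_iff_mem_nhds.2 fun t ht => ?_⟩
    · filter_upwards [key t] with s hs h using ht (hs.1 h)
    · filter_upwards [key t] with s hs using hs.2 ht
  exact (hclopen.eq_univ ⟨0, h0⟩).ge (Set.mem_univ t)

end Lifts

end Toda

namespace Toda

/-! ### Scaling of Kähler forms and the Cartan matrix -/

section Forms

variable {S : Type*} [TopologicalSpace S] [ChartedSpace ℂ S]

theorem density_const_smul (e : OpenPartialHomeomorph S ℂ) (c : ℝ) (Ω : TwoForm S) (z : ℂ) :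
    density e (fun x => c • Ω x) z = c * density e Ω z := rfl

/-- The derivative of the inverse chart is injective and complex linear, so the density evaluates
the form on a pair `v, I • v` with `v ≠ 0`. -/
theorem IsKahlerForm.density_pos [IsManifold 𝓘(ℂ) 1 S] {Ω : TwoForm S} (hΩ : IsKahlerForm Ω)
    {e : OpenPartialHomeomorph S ℂ} (he : e ∈ atlas ℂ S) {z : ℂ} (hz : z ∈ e.target) :
    0 < density e Ω z := by
  have hinj := (mdifferentiable_of_mem_atlas (I := 𝓘(ℂ)) he).symm.mfderiv_injective hz
  have h1 : mfderiv 𝓘(ℂ) 𝓘(ℂ) e.symm z (1 : ℂ) ≠ 0 := by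
    intro h
    have h2 := hinj (h.trans (map_zero (mfderiv 𝓘(ℂ) 𝓘(ℂ) e.symm z)).symm)
    exact one_ne_zero (α := ℂ) h2
  have hI : mfderiv 𝓘(ℂ) 𝓘(ℂ) e.symm z Complex.I =
      Complex.I • mfderiv 𝓘(ℂ) 𝓘(ℂ) e.symm z (1 : ℂ) := by
    have h3 := (mfderiv 𝓘(ℂ) 𝓘(ℂ) e.symm z).map_smul Complex.I (1 : ℂ)
    rw [← h3]
    congr 1
    exact (mul_one Complex.I).symm
  rw [density, hI]
  exact hΩ.pos _ _ h1

theorem IsKahlerForm.const_smul {Ω : TwoForm S} (hΩ : IsKahlerForm Ω) {c : ℝ} (hc : 0 < c) :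
    IsKahlerForm fun x => c • Ω x where
  smooth e he := contDiffOn_const.mul (hΩ.smooth e he)
  pos x v hv := mul_pos hc (hΩ.pos x v hv)

/-- The Ricci form is invariant under scaling. -/
theorem IsKahlerForm.ricciForm_const_smul [IsManifold 𝓘(ℂ) 1 S] {Ω : TwoForm S}
    (hΩ : IsKahlerForm Ω) {c : ℝ} (hc : 0 < c) (p : S) :
    ricciForm (fun x => c • Ω x) p = ricciForm Ω p := by
  have he := chart_mem_atlas ℂ p
  have ht : (chartAt ℂ p).target ∈ 𝓝 (chartAt ℂ p p) :=
    (chartAt ℂ p).open_target.mem_nhds (mem_chart_target ℂ p)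
  have hd : ContDiffAt ℝ 2 (fun z => Real.log (density (chartAt ℂ p) Ω z)) (chartAt ℂ p p) :=
    (((hΩ.smooth _ he).contDiffAt ht).of_le (WithTop.coe_le_coe.2 le_top)).log
      (hΩ.density_pos he (mem_chart_target ℂ p)).ne'
  have heq : (fun z => Real.log (density (chartAt ℂ p) (fun x => c • Ω x) z)) =ᶠ[𝓝 (chartAt ℂ p p)]
      (fun _ => Real.log c) + fun z => Real.log (density (chartAt ℂ p) Ω z) := by
    filter_upwards [ht] with z hz
    rw [density_const_smul, Real.log_mul hc.ne' (hΩ.density_pos he hz).ne', Pi.add_apply]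
  have hL : Laplacian.laplacian (fun z => Real.log (density (chartAt ℂ p) (fun x => c • Ω x) z))
      (chartAt ℂ p p) =
      Laplacian.laplacian (fun z => Real.log (density (chartAt ℂ p) Ω z)) (chartAt ℂ p p) := by
    rw [(InnerProductSpace.laplacian_congr_nhds heq).self_of_nhds,
      ContDiffAt.laplacian_add contDiffAt_const hd]
    simp
  rw [ricciForm, ricciForm, iDDbar, iDDbar, dzdzbar, dzdzbar, hL]

/-- The Cartan matrix is minus the second difference, and `i (n + 1 - i)` is quadratic in `i` with
leading coefficient -1. It vanishes at `i = 0` and `i = n + 1`, so the missing neighbours at the two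
ends do no harm. -/
theorem sum_cartanMatrix_A_mul (n : ℕ) (i : Fin n) :
    ∑ j, ((CartanMatrix.A n j i : ℤ) : ℝ) *
      ((((j : ℕ) : ℝ) + 1) * ((n : ℝ) + 1 - (((j : ℕ) : ℝ) + 1))) = 2 := by
  have hterm : ∀ j : Fin n, ((CartanMatrix.A n j i : ℤ) : ℝ) *
      ((((j : ℕ) : ℝ) + 1) * ((n : ℝ) + 1 - (((j : ℕ) : ℝ) + 1))) =
      (if (j : ℕ) = i then 2 * (((i : ℕ) : ℝ) + 1) * ((n : ℝ) - i) else 0) -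
      (if (j : ℕ) + 1 = i then ((i : ℕ) : ℝ) * ((n : ℝ) + 1 - i) else 0) -
      (if (j : ℕ) = i + 1 then (((i : ℕ) : ℝ) + 2) * ((n : ℝ) - i - 1) else 0) := by
    intro j
    simp only [CartanMatrix.A, Matrix.of_apply, Fin.ext_iff]
    rcases eq_or_ne (j : ℕ) i with h | h
    · simp [h]; ring
    · rcases eq_or_ne ((j : ℕ) + 1) i with h' | h'
      · have h3 : (i : ℕ) ≠ j := by omega
        have h4 : ¬ (j : ℕ) = i + 1 := by omega
        have h5 : ((i : ℕ) : ℝ) = (j : ℕ) + 1 := by rw [← h']; push_cast; ring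
        rw [if_neg h, if_pos (Or.inl h'), if_neg h, if_pos h', if_neg h4, h5]
        push_cast
        ring
      · rcases eq_or_ne (j : ℕ) (i + 1) with h6 | h6
        · have h7 : ((j : ℕ) : ℝ) = (i : ℕ) + 1 := by rw [h6]; push_cast; ring
          rw [if_neg h, if_pos (Or.inr h6.symm), if_neg h, if_neg h', if_pos h6, h7]
          push_cast
          ring
        · have h8 : ¬ ((j : ℕ) + 1 = i ∨ (i : ℕ) + 1 = j) := by omega
          rw [if_neg h, if_neg h8, if_neg h, if_neg h', if_neg h6]
          simp
  rw [Finset.sum_congr rfl fun j _ => hterm j, Finset.sum_sub_distrib, Finset.sum_sub_distrib]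
  have h1 : (∑ j : Fin n, if (j : ℕ) = i then 2 * (((i : ℕ) : ℝ) + 1) * ((n : ℝ) - i) else 0) =
      2 * (((i : ℕ) : ℝ) + 1) * ((n : ℝ) - i) := by
    rw [Finset.sum_eq_single i (fun b _ hb => if_neg fun h => hb (Fin.ext h)) (by simp), if_pos rfl]
  have h2 : (∑ j : Fin n, if (j : ℕ) + 1 = i then ((i : ℕ) : ℝ) * ((n : ℝ) + 1 - i) else 0) =
      ((i : ℕ) : ℝ) * ((n : ℝ) + 1 - i) := by
    rcases Nat.eq_zero_or_pos (i : ℕ) with h0 | h0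
    · simp [h0]
    · have hi := i.2
      rw [Finset.sum_eq_single ⟨(i : ℕ) - 1, by omega⟩
        (fun b _ hb => if_neg fun h => hb (Fin.ext (by simp only; omega))) (by simp),
        if_pos (by simp only; omega)]
  have h3 : (∑ j : Fin n, if (j : ℕ) = i + 1 then (((i : ℕ) : ℝ) + 2) * ((n : ℝ) - i - 1) else 0) =
      (((i : ℕ) : ℝ) + 2) * ((n : ℝ) - i - 1) := by
    rcases Nat.lt_or_ge ((i : ℕ) + 1) n with h0 | h0
    · rw [Finset.sum_eq_single ⟨(i : ℕ) + 1, h0⟩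
        (fun b _ hb => if_neg fun h => hb (Fin.ext h)) (by simp), if_pos rfl]
    · have hi : (i : ℕ) + 1 = n := le_antisymm i.2 h0
      have hn : (n : ℝ) = (i : ℕ) + 1 := by exact_mod_cast hi.symm
      rw [Finset.sum_eq_zero fun j _ => if_neg (by have := j.2; omega), hn]
      ring
  rw [h1, h2, h3]
  ring

theorem reduced_coeff_pos {n : ℕ} (k : Fin n) :
    0 < (((k : ℕ) : ℝ) + 1) * ((n : ℝ) + 1 - (((k : ℕ) : ℝ) + 1)) := by
  have : ((k : ℕ) : ℝ) < n := by exact_mod_cast k.2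
  exact mul_pos (by positivity) (by linarith)

/-- Both sides equal `4 Ω`: the left one by scale invariance of the Ricci form, the right one
because the Cartan sum is 2. -/
theorem isTodaSolution_reducedTuple [IsManifold 𝓘(ℂ) 1 S] (n : ℕ) {Ω : TwoForm S}
    (hΩ : IsTodaSolution 1 fun _ => Ω) : IsTodaSolution n (reducedTuple n Ω) where
  kahler k := (hΩ.kahler 0).const_smul (reduced_coeff_pos k)
  ricci_eq k p := by
    have h1 : ricciForm Ω p = (4 : ℝ) • Ω p := by
      have := hΩ.ricci_eq 0 p
      simp only [CartanMatrix.A] at this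
      rw [this]
      simp [smul_smul]
      norm_num
    have h2 : ricciForm (reducedTuple n Ω k) p = ricciForm Ω p :=
      (hΩ.kahler 0).ricciForm_const_smul (reduced_coeff_pos k) p
    rw [h2, h1]
    simp only [reducedTuple, smul_smul]
    rw [← Finset.sum_smul, sum_cartanMatrix_A_mul, smul_smul]
    norm_num

theorem iDDbar_eq (e : OpenPartialHomeomorph S ℂ) (φ : ℂ → ℝ) (p : S) :
    (1 / 2 : ℝ) • iDDbar e φ p = (1 / 4 * Laplacian.laplacian φ (e p)) • areaForm e p := by
  rw [iDDbar, dzdzbar, smul_smul]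
  congr 1
  ring

end Forms

/-! ### Transport of associated curves and comparison of germs -/

section Transport

variable {S : Type*} [TopologicalSpace S] {m n : ℕ}

theorem IsLift.post {e : OpenPartialHomeomorph S ℂ} {q : GermAt S (CP 1)}
    {F : ℂ → Fin (1 + 1) → ℂ} (hF : IsLift e q F)
    (U : Matrix.specialUnitaryGroup (Fin (n + 1)) ℂ) :
    IsLift e (q.post (psuMap U ∘ rationalNormalMap n)) fun w =>
      (U : Matrix (Fin (n + 1)) (Fin (n + 1)) ℂ).mulVec (rationalNormalVec n (F w)) := by
  obtain ⟨h, hq⟩ := exists_eq_germAt q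
  rw [hq] at hF ⊢
  obtain ⟨ha, hl⟩ := isLift_germAt_iff.1 hF
  rw [post_germAt, isLift_germAt_iff]
  refine ⟨analyticAt_mulVec _ (analyticAt_rationalNormalVec n ha), ?_⟩
  filter_upwards [hl] with y ⟨hy, hh⟩
  obtain ⟨h1, h2⟩ := psuMap_mk U _ (rationalNormalVec_ne_zero n hy)
  exact ⟨h1, by rw [Function.comp_apply, Function.comp_apply, hh, rationalNormalMap_mk, h2]⟩

variable [ChartedSpace ℂ S]

theorem IsMultivaluedCurve.postcomp {v : Set (GermAt S (CP 1))} (hv : IsMultivaluedCurve v)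
    (U : Matrix.specialUnitaryGroup (Fin (n + 1)) ℂ) :
    IsMultivaluedCurve (postcomp (psuMap U ∘ rationalNormalMap n) v) where
  nonempty := hv.nonempty.image _
  holomorphic := by
    rintro _ ⟨q, hq, rfl⟩ e he hqe
    obtain ⟨F, hF⟩ := hv.holomorphic q hq e he hqe
    exact ⟨_, hF.post U⟩
  isOpen := by
    rintro h x ⟨q, hq, hqx⟩
    obtain ⟨h', hq'⟩ := exists_eq_germAt q
    obtain rfl : q.1 = x := congrArg Sigma.fst hqx
    rw [hq', post_germAt] at hqx
    rw [hq'] at hq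
    filter_upwards [hv.isOpen h' _ hq, (germAt_eq_iff.1 hqx).eventuallyEq_nhds] with y h1 h2
    exact ⟨germAt h' y, h1, by rw [post_germAt]; exact germAt_eq_iff.2 h2⟩
  continuation := by
    rintro _ ⟨q, hq, rfl⟩ γ hγ
    obtain ⟨Γ, h1, h2, h3⟩ := hv.continuation q hq γ hγ
    exact ⟨fun t => (Γ t).post _, h1.post _, congrArg _ h2,
      fun t => ⟨(h3 t).1, Γ t, (h3 t).2, rfl⟩⟩
  connected := by
    rintro _ ⟨p, hp, rfl⟩ _ ⟨q, hq, rfl⟩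
    obtain ⟨Γ, h1, h2, h3, h4⟩ := hv.connected p hp q hq
    exact ⟨fun t => (Γ t).post _, h1.post _, congrArg _ h2, congrArg _ h3,
      fun t => ⟨Γ t, h4 t, rfl⟩⟩

/-- Continuations of `φ ∘ v` lift to continuations of `v`. -/
theorem IsMultivaluedCurve.exists_lift_continuation {v : Set (GermAt S (CP m))}
    (hv : IsMultivaluedCurve v) (φ : CP m → CP n)
    (hφ : ∀ q ∈ v, IsHolomorphicGerm (q.post φ))
    {Γ : unitInterval → GermAt S (CP n)} (hΓ : IsContinuation Γ)
    (hol : ∀ t, IsHolomorphicGerm (Γ t)) {q : GermAt S (CP m)} (hq : q ∈ v)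
    (h0 : Γ 0 = q.post φ) :
    ∃ Γ' : unitInterval → GermAt S (CP m), IsContinuation Γ' ∧ Γ' 0 = q ∧ (∀ t, Γ' t ∈ v) ∧
      ∀ t, Γ t = (Γ' t).post φ := by
  -- The germ `q` is continued in `v` along the base path of `Γ`; uniqueness of continuation
  -- identifies its image with `Γ`.
  obtain ⟨Γ', h1, h2, h3⟩ := hv.continuation q hq ⟨fun t => (Γ t).1, hΓ.1⟩ (by
    rw [ContinuousMap.coe_mk, h0]; rfl)
  refine ⟨Γ', h1, h2, fun t => (h3 t).2, ?_⟩
  exact hΓ.eq_of_eq_zero (h1.post φ) hol (fun t => hφ _ (h3 t).2) (fun t => (h3 t).1)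
    (by rw [h0, h2])

/-- A continuation over a loop lifts to `v`, where it acts by some `V` in `SU(2)`. Equivariance
turns `V` into `R` in `SU(n+1)`, and the monodromy of the composite is the conjugate `U R U⁻¹`. -/
theorem IsUnitaryCurve.postcomp {v : Set (GermAt S (CP 1))} (hv : IsUnitaryCurve v)
    (U : Matrix.specialUnitaryGroup (Fin (n + 1)) ℂ) :
    IsUnitaryCurve (postcomp (psuMap U ∘ rationalNormalMap n) v) where
  toIsMultivaluedCurve := hv.toIsMultivaluedCurve.postcomp U
  monodromy Γ hΓ hmem hloop := by
    have hw := hv.toIsMultivaluedCurve.postcomp (n := n) U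
    obtain ⟨q, hq, h0⟩ := hmem 0
    obtain ⟨Γ', h1, h2, h3, h4⟩ := hv.toIsMultivaluedCurve.exists_lift_continuation
      (psuMap U ∘ rationalNormalMap n) (fun q hq => hw.isHolomorphicGerm ⟨q, hq, rfl⟩) hΓ
      (fun t => hw.isHolomorphicGerm (hmem t)) hq h0.symm
    have hloop' : (Γ' 0).1 = (Γ' 1).1 := by
      rw [h4 0, h4 1] at hloop
      exact hloop
    obtain ⟨V, hV⟩ := hv.monodromy Γ' h1 h3 hloop'
    obtain ⟨R, hR⟩ := exists_rationalNormalMap_comp_psuMap n V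
    refine ⟨U * R * U⁻¹, ?_⟩
    rw [h4 1, h4 0, hV, post_post, post_post]
    congr 1
    funext p
    simp only [Function.comp_apply, hR]
    rw [← psuMap_mul, ← psuMap_mul, inv_mul_cancel_right]

theorem specialUnitary_mem_unitaryGroup (U : Matrix.specialUnitaryGroup (Fin (n + 1)) ℂ) :
    (U : Matrix (Fin (n + 1)) (Fin (n + 1)) ℂ) ∈ Matrix.unitaryGroup (Fin (n + 1)) ℂ :=
  Matrix.specialUnitaryGroup_le_unitaryGroup U.2

theorem IsAssociatedCurve.postcomp {Ω : TwoForm S} {v : Set (GermAt S (CP 1))}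
    (hv : IsAssociatedCurve (fun _ => Ω) v) (U : Matrix.specialUnitaryGroup (Fin (n + 1)) ℂ) :
    IsAssociatedCurve (reducedTuple n Ω)
      (Toda.postcomp (psuMap U ∘ rationalNormalMap n) v) := by
  -- The value `k = n` lies beyond the range of the tuple: its coefficient is 0, and only the
  -- nonvanishing is used, for unramifiedness.
  have key : ∀ q ∈ v, ∀ e ∈ atlas ℂ S, q.1 ∈ e.source → ∀ G,
      IsLift e (q.post (psuMap U ∘ rationalNormalMap n)) G → ∀ k ≤ n,
      wedgeNormSq (k + 1) G (e q.1) ≠ 0 ∧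
      (((k : ℝ) + 1) * ((n : ℝ) + 1 - ((k : ℝ) + 1))) • Ω q.1 =
        (1 / 2 : ℝ) • iDDbar e (fun z => Real.log (wedgeNormSq (k + 1) G z)) q.1 := by
    intro q hq e he hqe G hG k hk
    obtain ⟨F, hF⟩ := hv.unitary.holomorphic q hq e he hqe
    obtain ⟨c, hc, hc0, hGF⟩ := IsLift.exists_eq_smul
      (p := q.post (psuMap U ∘ rationalNormalMap n)) hqe (hF.post U) hG
    obtain ⟨h1, h2⟩ := laplacian_log_wedgeNormSq hk hF.analytic hF.ne_zero
      (hv.unramified q hq e he hqe F hF) hc hc0 (specialUnitary_mem_unitaryGroup U) hGF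
    refine ⟨h1, ?_⟩
    have h3 : Ω q.1 = (1 / 4 * Laplacian.laplacian (fun w => Real.log (wedgeNormSq 1 F w))
        (e q.1)) • areaForm e q.1 :=
      (hv.pullback_eq q hq e he hqe F hF 0).trans (iDDbar_eq _ _ _)
    rw [h3, iDDbar_eq, h2, smul_smul]
    congr 1
    push_cast [hk]
    ring
  refine ⟨hv.unitary.postcomp U, ?_, ?_⟩
  · rintro _ ⟨q, hq, rfl⟩ e he hqe G hG hW
    refine (key q hq e he hqe G hG n le_rfl).1 ?_
    rw [wedgeNormSq_top]
    have : wronskian G (e q.1) = 0 := hW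
    rw [this]
    simp
  · rintro _ ⟨q, hq, rfl⟩ e he hqe G hG k
    exact (key q hq e he hqe G hG k k.2.le).2

/-- Positivity of the Kähler form rules out a zero area form, so coefficients of two expressions of
one form can be compared. -/
theorem areaForm_ne_zero {Ω : TwoForm S} (hΩ : IsKahlerForm Ω) {e : OpenPartialHomeomorph S ℂ}
    {p : S} {t : ℝ} (h : Ω p = t • areaForm e p) : areaForm e p ≠ 0 := by
  intro h0
  have h1 := hΩ.pos p (1 : ℂ) (one_ne_zero (α := ℂ))
  rw [h, h0, smul_zero] at h1
  exact lt_irrefl _ h1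

/-- Germs over the same point of associated curves of `Ω` and of the reduced tuple are related by
the rational normal map up to a unitary transformation. -/
theorem IsAssociatedCurve.exists_germ_eq (hn : 0 < n) {Ω : TwoForm S} (hΩ : IsKahlerForm Ω)
    {v : Set (GermAt S (CP 1))} (hv : IsAssociatedCurve (fun _ => Ω) v)
    {f : Set (GermAt S (CP n))} (hf : IsAssociatedCurve (reducedTuple n Ω) f)
    {x : S} {h : S → CP 1} {g : S → CP n} (hq : germAt h x ∈ v) (hp : germAt g x ∈ f) :
    ∃ U : Matrix.specialUnitaryGroup (Fin (n + 1)) ℂ,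
      germAt g x = (germAt h x).post (psuMap U ∘ rationalNormalMap n) := by
  set e := chartAt ℂ x
  have he : e ∈ atlas ℂ S := chart_mem_atlas ℂ x
  have hxe : x ∈ e.source := mem_chart_source ℂ x
  obtain ⟨F, hF⟩ := hv.unitary.holomorphic _ hq e he hxe
  obtain ⟨G, hG⟩ := hf.unitary.holomorphic _ hp e he hxe
  have hFa : AnalyticAt ℂ F (e x) := hF.analytic
  have hGa : AnalyticAt ℂ G (e x) := hG.analytic
  have hF0 : F (e x) ≠ 0 := hF.ne_zero
  have hL : ∀ᶠ w in 𝓝 (e x), Laplacian.laplacian (fun w => Real.log (wedgeNormSq 1 G w)) w =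
      Laplacian.laplacian
        (fun w => Real.log (wedgeNormSq 1 (fun w => rationalNormalVec n (F w)) w)) w := by
    rw [← eventually_nhds_chart hxe]
    filter_upwards [hF.eventually hxe, hG.eventually hxe, hv.unitary.isOpen h x hq,
      hf.unitary.isOpen g x hp, e.open_source.mem_nhds hxe] with y hFy hGy hqy hpy hye
    have h1 : Ω y = (1 / 4 * Laplacian.laplacian (fun w => Real.log (wedgeNormSq 1 F w)) (e y)) •
        areaForm e y := (hv.pullback_eq _ hqy e he hye F hFy 0).trans (iDDbar_eq _ _ _)
    -- Only the first form of the tuple, `n Ω`, is needed: it is the Fubini–Study pullback by `f`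
    -- itself.
    have h2 : ((((0 : ℕ) : ℝ) + 1) * ((n : ℝ) + 1 - (((0 : ℕ) : ℝ) + 1))) • Ω y =
        (1 / 4 * Laplacian.laplacian (fun w => Real.log (wedgeNormSq 1 G w)) (e y)) •
        areaForm e y := (hf.pullback_eq _ hpy e he hye G hGy ⟨0, hn⟩).trans (iDDbar_eq _ _ _)
    have hne := areaForm_ne_zero hΩ h1
    rw [h1, smul_smul] at h2
    have h3 := smul_left_injective ℝ hne h2
    have h4 : Laplacian.laplacian
        (fun w => Real.log (wedgeNormSq (0 + 1) (fun w => rationalNormalVec n (F w)) w)) (e y) =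
        (((0 + 1) * (n - 0) : ℕ) : ℝ) *
          Laplacian.laplacian (fun w => Real.log (wedgeNormSq 1 F w)) (e y) :=
      (laplacian_log_wedgeNormSq (n := n) (k := 0) (Nat.zero_le n) hFy.analytic
      hFy.ne_zero (hv.unramified _ hqy e he hye F hFy) (c := fun _ => 1) analyticAt_const
      one_ne_zero (one_mem (Matrix.unitaryGroup (Fin (n + 1)) ℂ))
      (G := fun w => rationalNormalVec n (F w))
      (Filter.Eventually.of_forall fun w => by simp)).2
    simp only [zero_add, one_mul, Nat.sub_zero] at h4
    rw [h4]
    push_cast at h3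
    linear_combination -4 * h3
  obtain ⟨U, hU⟩ := exists_specialUnitary_of_laplacian_eq hGa
    (analyticAt_rationalNormalVec n hFa) hG.ne_zero (rationalNormalVec_ne_zero n hF0) hL
  refine ⟨U, ?_⟩
  rw [post_germAt, germAt_eq_iff]
  obtain ⟨-, hFl⟩ := isLift_germAt_iff.1 (hF.post (n := n) U)
  obtain ⟨-, hGl⟩ := isLift_germAt_iff.1 hG
  filter_upwards [hFl, hGl, (eventually_nhds_chart hxe).2 hU] with y ⟨h1, h2⟩ ⟨h3, h4⟩ ⟨c, hc, h5⟩
  rw [h4, h2, Projectivization.mk_eq_mk_iff']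
  exact ⟨c, h5.symm⟩

/-- Multi-valued curves sharing a germ up to post-composition agree up to post-composition. -/
theorem IsMultivaluedCurve.eq_postcomp {v : Set (GermAt S (CP m))} (hv : IsMultivaluedCurve v)
    {f : Set (GermAt S (CP n))} (hf : IsMultivaluedCurve f) (φ : CP m → CP n)
    (hφ : ∀ q ∈ v, IsHolomorphicGerm (q.post φ)) {q : GermAt S (CP m)} (hq : q ∈ v)
    (hp : q.post φ ∈ f) : f = Toda.postcomp φ v := by
  ext p'
  constructor
  · intro hp'
    obtain ⟨Γ, h1, h2, h3, h4⟩ := hf.connected _ hp p' hp'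
    obtain ⟨Γ', -, -, h7, h8⟩ := hv.exists_lift_continuation φ hφ h1
      (fun t => hf.isHolomorphicGerm (h4 t)) hq h2
    exact ⟨Γ' 1, h7 1, by rw [← h8 1, h3]⟩
  · rintro ⟨q', hq', rfl⟩
    obtain ⟨Γ, h1, h2, h3, h4⟩ := hv.connected q hq q' hq'
    -- The continuation inside `f` over the same base path must be the image of `Γ`, so its endpoint
    -- shows that the image of `q'` lies in `f`.
    obtain ⟨Γ', h5, h6, h7⟩ := hf.continuation _ hp ⟨fun t => (Γ t).1, h1.1⟩ (by
      rw [ContinuousMap.coe_mk, h2]; rfl)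
    have h8 := (h1.post φ).eq_of_eq_zero h5 (fun t => hφ _ (h4 t))
      (fun t => hf.isHolomorphicGerm (h7 t).2) (fun t => (h7 t).1) (by rw [h6, h2]) 1
    rw [h3] at h8
    rw [h8]
    exact (h7 1).2

end Transport

end Toda

/-! ### Assembly of the theorem -/

theorem theorem1p1 {S : Type*} [TopologicalSpace S] [T2Space S] [ConnectedSpace S]
    [ChartedSpace ℂ S] [IsManifold 𝓘(ℂ) ω S]
    (n : ℕ) (hn : 0 < n)
    (Ω : Toda.TwoForm S) (hΩ : Toda.IsTodaSolution 1 (fun _ => Ω))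
    (v : Set (Toda.GermAt S (Toda.CP 1))) (hv : Toda.IsAssociatedCurve (fun _ => Ω) v) :
    Toda.IsTodaSolution n (Toda.reducedTuple n Ω) ∧
      {f : Set (Toda.GermAt S (Toda.CP n)) |
          Toda.IsAssociatedCurve (Toda.reducedTuple n Ω) f} =
        {f | ∃ U : Matrix.specialUnitaryGroup (Fin (n + 1)) ℂ,
          f = Toda.postcomp (Toda.psuMap U ∘ Toda.rationalNormalMap n) v} := by
  have : IsManifold 𝓘(ℂ) 1 S := IsManifold.of_le (n := ω) le_top
  refine ⟨Toda.isTodaSolution_reducedTuple n hΩ, Set.ext fun f => ⟨fun hf => ?_, ?_⟩⟩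
  · have : LocallyPathConnectedSpace S := ChartedSpace.locallyPathConnectedSpace ℂ S
    have : PathConnectedSpace S := pathConnectedSpace_iff_connectedSpace.2 inferInstance
    have hf' : Toda.IsAssociatedCurve (Toda.reducedTuple n Ω) f := hf
    obtain ⟨p, hp⟩ := hf'.unitary.nonempty
    obtain ⟨q₀, hq₀⟩ := hv.unitary.nonempty
    -- Rigidity compares germs over one point, so a germ of `v` is continued along a path to the
    -- base point of a germ of `f`.
    let γ := PathConnectedSpace.somePath q₀.1 p.1
    obtain ⟨Γ, -, -, h3⟩ := hv.unitary.continuation q₀ hq₀ γ.toContinuousMap γ.source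
    have hq : Γ 1 ∈ v := (h3 1).2
    have hbase : (Γ 1).1 = p.1 := (h3 1).1.trans γ.target
    obtain ⟨g, hg⟩ := Toda.exists_eq_germAt p
    obtain ⟨h, hh⟩ := Toda.exists_eq_germAt (Γ 1)
    rw [hbase] at hh
    rw [hg] at hp
    rw [hh] at hq
    obtain ⟨U, hU⟩ := hv.exists_germ_eq hn (hΩ.kahler 0) hf' hq hp
    refine ⟨U, hv.unitary.toIsMultivaluedCurve.eq_postcomp hf'.unitary.toIsMultivaluedCurve _
      (fun q hq => (hv.unitary.toIsMultivaluedCurve.postcomp U).isHolomorphicGerm ⟨q, hq, rfl⟩)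
      hq (by rw [← hU]; exact hp)⟩
  · rintro ⟨U, rfl⟩
    exact hv.postcomp U
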